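/- Setting. Let $d,m\ge 0$, and let $\mathcal H$ be a commutative real Hopf algebra with a Hopf algebra grading $\mathcal H=\bigoplus_{n\ge0}\mathcal H_n$ such that $\mathcal H_0=\mathbb R\mathbf 1$; write $|h|=n$ for $0\neq h\in\mathcal H_n$. Let $\langle\cdot,\cdot\rangle_{\mathcal H}$ be a symmetric bilinear form on $\mathcal H$, and let $L_1,\dots,L_d:\mathcal H\to\mathcal H$ be linear maps, homogeneous of degree one, such that $$\Delta L_\alpha(u)=(\mathrm{id}\otimes L_\alpha)\Delta u+L_\alpha(u)\otimes\mathbf 1,\qquad \langle L_\alpha(x),L_\beta(y)\rangle_{\mathcal H}=\delta_{\alpha\beta}\langle x,y\rangle_{\mathcal H},$$ and such that $L_1(\mathbf 1),\dots,L_d(\mathbf 1)$ is a basis of $\mathcal H_1$. Trees. Let $\mathcal T$ be the set of non-planar rooted trees with vertices decorated by $\{1,\dots,d\}$, $|\tau|$ the number of vertices of $\tau$, and $S(\tau)$ its symmetry factor: if the pairwise different branches $\tau_j$ of $\tau$ have multiplicities $r_j$, then $S(\tau)=\prod_j r_j!\,S(\tau_j)^{r_j}$. Let $\mathcal H_{BCK}$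 be the commutative algebra of forests and $\Lambda:\mathcal H_{BCK}\to\mathcal H$ the unique algebra morphism with $\Lambda\circ B_+^\alpha=L_\alpha\circ\Lambda$, where $B_+^\alpha$ joins the trees of a forest to a new root decorated by $\alpha$. Let $\mathscr T$ be an orthogonal basis of $\mathrm{Im}\,\Lambda$ consisting of homogeneous elements $h$ with $\|h\|^2_{\mathcal H}:=\langle h,h\rangle_{\mathcal H}\ne0$ and containing $\mathbf 1$; put $\mathscr T_{\le n}=\{h\in\mathscr T:|h|\le n\}$. Elementary differentials. Let $f_1,\dots,f_d:\mathbb R^m\to\mathbb R^m$ be $C^\infty$. Put $$\Upsilon_f[B_+^\alpha(\tau_1\cdots\tau_n)](y)=D^nf_\alpha(y)\big(\Upsilon_f[\tau_1](y),\dots,\Upsilon_f[\tau_n](y)\big),\qquad \bar\Upsilon_f[h](y)=\sum_{\tau\in\mathcal T}\frac{\langle h,\Lambda(\tau)\rangle_{\mathcal H}}{S(\tau)}\,\Upsilon_f[\tau](y)\quad(h\in\mathscr T).$$ Rough path and solution. Let $0<\gamma\le1$, let $N$ be the largest integer with $N\gamma\le1$, and let $\mathbf X$ be a $\gamma$-Hölder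 $\mathcal H$-rough path on $[0,T]$: each $\mathbf X_{s,t}:\mathcal H\to\mathbb R$ is a unital algebra morphism; $\mathbf X_{s,t}=\mathbf X_{s,r}\star\mathbf X_{r,t}$ for $0\le s\le r\le t\le T$, where $\phi\star\psi=(\phi\otimes\psi)\circ\Delta$; and $\sup_{s\neq t}|\langle\mathbf X_{s,t},h\rangle|/|t-s|^{\gamma n}<\infty$ for all $n$ and $h\in\mathcal H_n$. Let $Y$ be a solution on $[0,T]$ of the cocycle-RDE $dY=\sum_\alpha f_\alpha(Y)\,dX^\alpha$ driven by $\mathbf X$, in the sense of Davie: uniformly in $0\le s\le t\le T$, as $t-s\to0$, $$Y_t=Y_s+\sum_{\tau\in\mathcal T,\ |\tau|\le N}\frac{\Upsilon_f[\tau](Y_s)}{S(\tau)}\langle\mathbf X_{s,t},\Lambda(\tau)\rangle+o(|t-s|).$$ Statement. For every integer $M\ge N$, the path $\mathbf Y:[0,T]\to\mathcal H^m$ with values in the span of $\mathscr T_{\le M-1}\cup\{\mathbf 1\}$ and with $\mathscr T$-coefficients $$\langle\mathbf 1,\mathbf Y_t\rangle=Y_t,\qquad \langle h,\mathbf Y_t\rangle=\frac{\bar\Upsilon_f[h](Y_t)}{\|h\|^2_{\mathcal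 H}}\qquad(h\in\mathscr T_{\le M-1}\setminus\{\mathbf 1\})$$ is an $\mathbf X$-controlled rough path. That is, there are constants such that for all $0\le s\le t\le T$ $$\Big|Y_t-Y_s-\sum_{h\in\mathscr T_{\le N-1}\setminus\{\mathbf 1\}}\langle h,\mathbf Y_s\rangle\langle\mathbf X_{s,t},h\rangle\Big|\le C_1|t-s|^{N\gamma},$$ and for every $h\in\mathscr T_{\le N-1}$ $$\Big|\langle h,\mathbf Y_t\rangle-\sum_{g\in\mathscr T_{\le N-1}}\langle g,\mathbf Y_s\rangle\,\big\langle\mathbf X_{s,t}\star h/\|h\|^2_{\mathcal H},\,g\big\rangle\Big|\le C_2|t-s|^{(N-|h|)\gamma},$$ where $h$ in the second factor of $\star$ stands for the linear form $\langle h,\cdot\rangle_{\mathcal H}$; and $\mathbf Y_t$ has no component outside the span of $\mathscr T$. -/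

import Mathlib

open scoped TensorProduct ContDiff

/-! ### Non-planar rooted trees with vertices decorated by `Fin d` -/

/-- Planar rooted trees with decorated vertices: a root decoration and an ordered list of branches. -/
inductive PlanarTree (d : ℕ) : Type
  | node (a : Fin d) (l : List (PlanarTree d)) : PlanarTree d

mutual
/-- Two planar trees are identified if one is obtained from the other by reordering branches,
at every vertex. -/
inductive PlanarTree.Rel {d : ℕ} : PlanarTree d → PlanarTree d → Prop
  | node (a : Fin d) {l l' : List (PlanarTree d)} :
      PlanarTree.RelList l l' → PlanarTree.Rel (.node a l) (.node a l')
/-- Lists of planar trees up to reordering of the list and of all branches. -/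
inductive PlanarTree.RelList {d : ℕ} : List (PlanarTree d) → List (PlanarTree d) → Prop
  | nil : PlanarTree.RelList [] []
  | cons {t t' : PlanarTree d} {l l' : List (PlanarTree d)} :
      PlanarTree.Rel t t' → PlanarTree.RelList l l' → PlanarTree.RelList (t :: l) (t' :: l')
  | swap (t u : PlanarTree d) (l : List (PlanarTree d)) :
      PlanarTree.RelList (t :: u :: l) (u :: t :: l)
  | trans {l l' l'' : List (PlanarTree d)} :
      PlanarTree.RelList l l' → PlanarTree.RelList l' l'' → PlanarTree.RelList l l''
end

namespace PlanarTree

variable {d : ℕ}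

mutual
theorem rel_refl : ∀ t : PlanarTree d, Rel t t
  | .node a l => .node a (relList_refl l)
theorem relList_refl : ∀ l : List (PlanarTree d), RelList l l
  | [] => .nil
  | t :: l => .cons (rel_refl t) (relList_refl l)
end

mutual
theorem rel_symm : ∀ {t t' : PlanarTree d}, Rel t t' → Rel t' t
  | _, _, .node a h => .node a (relList_symm h)
theorem relList_symm : ∀ {l l' : List (PlanarTree d)}, RelList l l' → RelList l' l
  | _, _, .nil => .nil
  | _, _, .cons h hl => .cons (rel_symm h) (relList_symm hl)
  | _, _, .swap t u l => .swap u t l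
  | _, _, .trans h h' => .trans (relList_symm h') (relList_symm h)
end

theorem rel_trans {t t' t'' : PlanarTree d} (h : Rel t t') (h' : Rel t' t'') : Rel t t'' := by
  cases h with
  | node a h => cases h' with
    | node _ h' => exact .node a (.trans h h')

theorem relList_of_perm {l l' : List (PlanarTree d)} (h : l.Perm l') : RelList l l' := by
  induction h with
  | nil => exact .nil
  | cons t _ ih => exact .cons (rel_refl t) ih
  | swap t u l => exact .swap u t l
  | trans _ _ ih ih' => exact .trans ih ih'

instance setoid (d : ℕ) : Setoid (PlanarTree d) :=
  ⟨Rel, rel_refl, rel_symm, rel_trans⟩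

end PlanarTree

/-- Non-planar rooted trees whose vertices are decorated by `Fin d`. -/
def DecoratedTree (d : ℕ) : Type := Quotient (PlanarTree.setoid d)

namespace DecoratedTree

variable {d : ℕ}

/-- The non-planar tree underlying a planar tree. -/
def mk (t : PlanarTree d) : DecoratedTree d := Quotient.mk _ t

/-- A planar representative of a non-planar tree. -/
noncomputable def rep (t : DecoratedTree d) : PlanarTree d := Quotient.out t

theorem mk_rep (t : DecoratedTree d) : mk t.rep = t := Quotient.out_eq t

theorem mk_eq_iff {t t' : PlanarTree d} : mk t = mk t' ↔ PlanarTree.Rel t t' := Quotient.eq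

/-- Grafting a forest, i.e. a multiset of trees, onto a new root decorated by `a`. -/
noncomputable def graft (a : Fin d) (s : Multiset (DecoratedTree d)) : DecoratedTree d :=
  Quotient.liftOn s (fun l => mk (.node a (l.map rep))) fun _ _ h =>
    mk_eq_iff.2 (.node a (PlanarTree.relList_of_perm (List.Perm.map rep h)))

end DecoratedTree

namespace PlanarTree

variable {d : ℕ} {β : Type*}

mutual
/-- Recursion over a tree: the value at a tree is computed from the decoration of the root and
from the unordered collection of the branches with their values. -/
def fold (g : Fin d → Multiset (DecoratedTree d × β) → β) : PlanarTree d → β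
  | .node a l => g a (foldList g l)
/-- The unordered collection of the (non-planar) trees of a list, with their values. -/
def foldList (g : Fin d → Multiset (DecoratedTree d × β) → β) :
    List (PlanarTree d) → Multiset (DecoratedTree d × β)
  | [] => 0
  | t :: l => (DecoratedTree.mk t, fold g t) ::ₘ foldList g l
end

mutual
theorem fold_congr (g : Fin d → Multiset (DecoratedTree d × β) → β) :
    ∀ {t t' : PlanarTree d}, Rel t t' → fold g t = fold g t'
  | _, _, .node _ h => by rw [fold, fold, foldList_congr g h]
theorem foldList_congr (g : Fin d → Multiset (DecoratedTree d × β) → β) :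
    ∀ {l l' : List (PlanarTree d)}, RelList l l' → foldList g l = foldList g l'
  | _, _, .nil => rfl
  | _, _, .cons h hl => by
      rw [foldList, foldList, fold_congr g h, foldList_congr g hl, DecoratedTree.mk_eq_iff.2 h]
  | _, _, .swap t u l => by
      simp only [foldList]; exact Multiset.cons_swap _ _ _
  | _, _, .trans h h' => (foldList_congr g h).trans (foldList_congr g h')
end

theorem foldList_eq (g : Fin d → Multiset (DecoratedTree d × β) → β) (l : List (PlanarTree d)) :
    foldList g l = ((l.map fun t => (DecoratedTree.mk t, fold g t) : List _) : Multiset _) := by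
  induction l with
  | nil => rfl
  | cons t l ih => rw [foldList, ih]; rfl

theorem relList_map_rep (l : List (PlanarTree d)) :
    RelList ((l.map DecoratedTree.mk).map DecoratedTree.rep) l := by
  induction l with
  | nil => exact .nil
  | cons t l ih => exact .cons (DecoratedTree.mk_eq_iff.1 (DecoratedTree.mk_rep _)) ih

end PlanarTree

namespace DecoratedTree

variable {d : ℕ} {β : Type*}

/-- Recursion over non-planar trees, see `fold_graft`. -/
def fold (g : Fin d → Multiset (DecoratedTree d × β) → β) (t : DecoratedTree d) : β :=
  Quotient.liftOn t (PlanarTree.fold g) fun _ _ h => PlanarTree.fold_congr g h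

theorem fold_graft (g : Fin d → Multiset (DecoratedTree d × β) → β) (a : Fin d)
    (s : Multiset (DecoratedTree d)) :
    fold g (graft a s) = g a (s.map fun t => (t, fold g t)) := by
  induction s using Quotient.inductionOn with
  | h l =>
    change g a (PlanarTree.foldList g (l.map rep)) = _
    rw [PlanarTree.foldList_eq, List.map_map]
    congr 1
    change _ = Multiset.ofList (l.map fun t => (t, fold g t))
    congr 1
    refine List.map_congr_left fun t _ => ?_
    have h : PlanarTree.fold g t.rep = fold g t := by
      conv_rhs => rw [← mk_rep t]
      rfl
    simp [mk_rep, h]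

theorem mk_node (a : Fin d) (l : List (PlanarTree d)) :
    mk (.node a l) = graft a (l.map mk : List (DecoratedTree d)) :=
  (mk_eq_iff.2 (.node a (PlanarTree.relList_map_rep l))).symm

mutual
theorem induction_planar {P : DecoratedTree d → Prop}
    (h : ∀ a s, (∀ t ∈ s, P t) → P (graft a s)) : ∀ t : PlanarTree d, P (mk t)
  | .node a l => by
      rw [mk_node]
      refine h a _ fun t ht => ?_
      obtain ⟨u, hu, rfl⟩ := List.mem_map.1 (Multiset.mem_coe.1 ht)
      exact induction_planarList h l u hu
theorem induction_planarList {P : DecoratedTree d → Prop}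
    (h : ∀ a s, (∀ t ∈ s, P t) → P (graft a s)) :
    ∀ l : List (PlanarTree d), ∀ t ∈ l, P (mk t)
  | [] => fun t ht => by simp at ht
  | u :: l => fun t ht => by
      have hu := induction_planar h u
      have hl := induction_planarList h l
      rcases List.mem_cons.1 ht with rfl | ht
      · exact hu
      · exact hl t ht
end

/-- Every tree is obtained from a single root by grafting a forest, and induction is possible. -/
theorem induction {P : DecoratedTree d → Prop} (h : ∀ a s, (∀ t ∈ s, P t) → P (graft a s))
    (t : DecoratedTree d) : P t := by
  rw [← mk_rep t]; exact induction_planar h _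

/-- The number of vertices of a tree. -/
def order : DecoratedTree d → ℕ := fold fun _ s => 1 + (s.map Prod.snd).sum

theorem order_graft (a : Fin d) (s : Multiset (DecoratedTree d)) :
    order (graft a s) = 1 + (s.map order).sum := by
  rw [order, fold_graft, Multiset.map_map]; rfl

open Classical in
/-- The symmetry factor: if a tree has the pairwise different branches `τ_j`, with respective
multiplicities `r_j`, then `S(τ) = ∏_j r_j! S(τ_j)^{r_j}`. -/
noncomputable def symmFactor : DecoratedTree d → ℕ :=
  fold fun _ s => ∏ p ∈ s.toFinset, (s.count p).factorial * p.2 ^ s.count p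

open Classical in
theorem symmFactor_graft (a : Fin d) (s : Multiset (DecoratedTree d)) :
    symmFactor (graft a s) = ∏ t ∈ s.toFinset, (s.count t).factorial * symmFactor t ^ s.count t := by
  have hinj : Function.Injective fun t : DecoratedTree d => (t, symmFactor t) :=
    fun _ _ h => congrArg Prod.fst h
  conv_lhs => rw [symmFactor, fold_graft]
  change (∏ p ∈ (s.map fun t => (t, symmFactor t)).toFinset, _) = _
  rw [Multiset.toFinset_map, Finset.prod_image hinj.injOn]
  refine Finset.prod_congr rfl fun t _ => ?_
  have h := Multiset.count_map_eq_count' (fun t : DecoratedTree d => (t, symmFactor t)) s hinj t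
  change (Multiset.count _ (s.map fun t => (t, symmFactor t))).factorial *
    _ ^ (Multiset.count _ (s.map fun t => (t, symmFactor t))) = _
  rw [h]

theorem one_le_order (t : DecoratedTree d) : 1 ≤ t.order :=
  induction (P := fun t => 1 ≤ t.order) (fun a s _ => by rw [order_graft]; omega) t

theorem finite_forest_of_finite {N : ℕ} (h : {t : DecoratedTree d | t.order ≤ N}.Finite) :
    {s : Multiset (DecoratedTree d) | (s.map order).sum ≤ N}.Finite := by
  classical
  refine (Set.finite_Iic (N • h.toFinset.val)).subset fun s hs => ?_
  have hs' : (s.map order).sum ≤ N := hs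
  have hcard : s.card ≤ N := by
    refine le_trans ?_ hs'
    have := Multiset.card_nsmul_le_sum (s := s.map order) (a := 1) (by
      intro x hx
      obtain ⟨t, _, rfl⟩ := Multiset.mem_map.1 hx
      exact one_le_order t)
    simpa using this
  refine Multiset.le_iff_count.2 fun t => ?_
  by_cases ht : t ∈ s
  · have hmem : t ∈ h.toFinset := by
      rw [Set.Finite.mem_toFinset]
      exact (Multiset.single_le_sum (fun _ _ => Nat.zero_le _) _
        (Multiset.mem_map_of_mem order ht)).trans hs'
    rw [Multiset.count_nsmul, Multiset.count_eq_one_of_mem h.toFinset.nodup hmem, mul_one]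
    exact (Multiset.count_le_card t s).trans hcard
  · rw [Multiset.count_eq_zero_of_notMem ht]; exact Nat.zero_le _

theorem finite_order_le (d N : ℕ) : {t : DecoratedTree d | t.order ≤ N}.Finite := by
  induction N with
  | zero =>
    refine Set.finite_empty.subset fun t ht => ?_
    have h0 : t.order ≤ 0 := ht
    have := one_le_order t
    omega
  | succ N ih =>
    refine ((Set.finite_univ (α := Fin d)).image2 graft (finite_forest_of_finite ih)).subset
      fun t => ?_
    refine induction
      (P := fun t => t ∈ {t : DecoratedTree d | t.order ≤ N + 1} → t ∈ Set.image2 graft _ _) ?_ t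
    intro a s _ h
    refine ⟨a, trivial, s, ?_, rfl⟩
    have h' : (graft a s).order ≤ N + 1 := h
    rw [order_graft] at h'
    change (s.map order).sum ≤ N
    omega

/-- The finite set of the trees with at most `N` vertices. -/
noncomputable def upTo (d N : ℕ) : Finset (DecoratedTree d) := (finite_order_le d N).toFinset

end DecoratedTree

/-! ### The algebra of forests and the morphism induced by a family of cocycles -/

/-- The free commutative algebra on the trees. The monomials are the forests and the product is
juxtaposition; this is the algebra underlying the Butcher-Connes-Kreimer Hopf algebra. -/
abbrev ForestAlgebra (d : ℕ) : Type := MvPolynomial (DecoratedTree d) ℝ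

/-- The linear map joining the trees of a forest to a new root decorated by `a`. -/
noncomputable def ForestAlgebra.graft {d : ℕ} (a : Fin d) :
    ForestAlgebra d →ₗ[ℝ] ForestAlgebra d :=
  (MvPolynomial.basisMonomials (DecoratedTree d) ℝ).constr ℝ fun s =>
    MvPolynomial.X (DecoratedTree.graft a (Finsupp.toMultiset s))

section Universal

variable {d : ℕ} {H : Type*} [CommRing H] [Algebra ℝ H]

/-- The morphism `Λ` from the algebra of forests induced by linear maps `L_a`; it is the unique
algebra morphism with `Λ ∘ B_+^a = L_a ∘ Λ`, see `universalMap_graft` and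
`universalMap_unique`. -/
noncomputable def universalMap (L : Fin d → H →ₗ[ℝ] H) : ForestAlgebra d →ₐ[ℝ] H :=
  MvPolynomial.aeval (DecoratedTree.fold fun a s => L a (s.map Prod.snd).prod)

theorem universalMap_graft (L : Fin d → H →ₗ[ℝ] H) (a : Fin d) (x : ForestAlgebra d) :
    universalMap L (ForestAlgebra.graft a x) = L a (universalMap L x) := by
  suffices h : (universalMap L).toLinearMap ∘ₗ ForestAlgebra.graft a =
      L a ∘ₗ (universalMap L).toLinearMap from LinearMap.congr_fun h x
  refine (MvPolynomial.basisMonomials (DecoratedTree d) ℝ).ext fun s => ?_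
  simp only [LinearMap.comp_apply, ForestAlgebra.graft, Module.Basis.constr_basis,
    AlgHom.toLinearMap_apply]
  rw [MvPolynomial.coe_basisMonomials, universalMap, MvPolynomial.aeval_X, DecoratedTree.fold_graft, MvPolynomial.aeval_monomial,
    map_one, one_mul, Multiset.map_map, Finsupp.prod, Finsupp.toMultiset_map,
    Finsupp.prod_toMultiset, Finsupp.prod_mapDomain_index (by simp) (by intros; rw [pow_add])]
  rfl

theorem universalMap_unique (L : Fin d → H →ₗ[ℝ] H) (φ : ForestAlgebra d →ₐ[ℝ] H)
    (h : ∀ a x, φ (ForestAlgebra.graft a x) = L a (φ x)) : φ = universalMap L := by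
  classical
  refine MvPolynomial.algHom_ext fun t => ?_
  refine DecoratedTree.induction
    (P := fun t => φ (MvPolynomial.X t) = universalMap L (MvPolynomial.X t)) ?_ t
  intro a s ih
  have key : (MvPolynomial.X (DecoratedTree.graft a s) : ForestAlgebra d) =
      ForestAlgebra.graft a (MvPolynomial.monomial (Multiset.toFinsupp s) 1) := by
    have := (MvPolynomial.basisMonomials (DecoratedTree d) ℝ).constr_basis ℝ
      (fun s => (MvPolynomial.X (DecoratedTree.graft a (Finsupp.toMultiset s)) : ForestAlgebra d))
      (Multiset.toFinsupp s)
    rw [MvPolynomial.coe_basisMonomials, Multiset.toFinsupp_toMultiset] at this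
    exact this.symm
  rw [key, h, universalMap_graft]
  congr 1
  rw [MvPolynomial.monomial_eq]
  simp only [map_one, one_mul, Finsupp.prod, map_prod, map_pow]
  refine Finset.prod_congr rfl fun t ht => ?_
  rw [ih t (by simpa using ht)]

end Universal

/-! ### Elementary differentials and B-series -/

section ElementaryDifferentials

variable {d m : ℕ}

/-- The elementary differential of a tree: for the tree with root `a` and branches
`τ_1, …, τ_n`, it is the `n`-th derivative of `f_a` at `y` applied to the values at `y` of the
elementary differentials of the branches, which is `f_a(y)` for `n = 0`. The branches are put in
an arbitrary order; for smooth `f_a` the order is irrelevant, see `elemDiff_graft`. -/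
noncomputable def elemDiff (f : Fin d → EuclideanSpace ℝ (Fin m) → EuclideanSpace ℝ (Fin m)) :
    DecoratedTree d → EuclideanSpace ℝ (Fin m) → EuclideanSpace ℝ (Fin m) :=
  DecoratedTree.fold fun a s y =>
    iteratedFDeriv ℝ s.toList.length (f a) y fun i => (s.toList.get i).2 y

theorem iteratedFDeriv_cons {g : EuclideanSpace ℝ (Fin m) → EuclideanSpace ℝ (Fin m)}
    (hg : ContDiff ℝ ∞ g) (v : EuclideanSpace ℝ (Fin m)) (l : List (EuclideanSpace ℝ (Fin m)))
    (y : EuclideanSpace ℝ (Fin m)) :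
    iteratedFDeriv ℝ (v :: l).length g y (v :: l).get =
      fderiv ℝ (fun z => iteratedFDeriv ℝ l.length g z l.get) y v := by
  have hd : DifferentiableAt ℝ (iteratedFDeriv ℝ l.length g) y :=
    (hg.differentiable_iteratedFDeriv (by exact_mod_cast WithTop.coe_lt_top _)).differentiableAt
  rw [fderiv_continuousMultilinear_apply_const_apply hd]
  exact iteratedFDeriv_succ_apply_left _

theorem iteratedFDeriv_perm {g : EuclideanSpace ℝ (Fin m) → EuclideanSpace ℝ (Fin m)}
    (hg : ContDiff ℝ ∞ g) {l l' : List (EuclideanSpace ℝ (Fin m))} (h : l.Perm l') :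
    ∀ y, iteratedFDeriv ℝ l.length g y l.get = iteratedFDeriv ℝ l'.length g y l'.get := by
  induction h with
  | nil => intro y; rfl
  | cons v _ ih =>
    intro y
    rw [iteratedFDeriv_cons hg, iteratedFDeriv_cons hg, funext ih]
  | swap u v l =>
    intro y
    have hG : ContDiff ℝ ∞ fun z => iteratedFDeriv ℝ l.length g z l.get := by
      have h1 : ContDiff ℝ ∞ (iteratedFDeriv ℝ l.length g) :=
        hg.iteratedFDeriv_right (m := ∞) (by exact_mod_cast le_top)
      exact (ContinuousMultilinearMap.apply ℝ (fun _ : Fin l.length => EuclideanSpace ℝ (Fin m))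
        (EuclideanSpace ℝ (Fin m)) l.get).contDiff.comp h1
    have hsymm : IsSymmSndFDerivAt ℝ (fun z => iteratedFDeriv ℝ l.length g z l.get) y :=
      hG.contDiffAt.isSymmSndFDerivAt (by
        rw [minSmoothness_of_isRCLikeNormedField]
        exact WithTop.coe_le_coe.2 le_top)
    have hdiff : DifferentiableAt ℝ (fderiv ℝ fun z => iteratedFDeriv ℝ l.length g z l.get) y :=
      ((hG.fderiv_right (m := ∞) (by simp)).differentiable (by simp)).differentiableAt
    rw [iteratedFDeriv_cons hg, iteratedFDeriv_cons hg,
      funext (iteratedFDeriv_cons hg u l), funext (iteratedFDeriv_cons hg v l),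
      fderiv_clm_apply hdiff (differentiableAt_const _),
      fderiv_clm_apply hdiff (differentiableAt_const _)]
    simpa using hsymm v u
  | trans _ _ ih ih' => intro y; rw [ih, ih']

theorem elemDiff_graft {f : Fin d → EuclideanSpace ℝ (Fin m) → EuclideanSpace ℝ (Fin m)}
    (hf : ∀ a, ContDiff ℝ ∞ (f a)) (a : Fin d) (l : List (DecoratedTree d))
    (y : EuclideanSpace ℝ (Fin m)) :
    elemDiff f (DecoratedTree.graft a (l : Multiset (DecoratedTree d))) y =
      iteratedFDeriv ℝ (l.map fun t => elemDiff f t y).length (f a) y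
        (l.map fun t => elemDiff f t y).get := by
  have key : ∀ q : List (DecoratedTree d × (EuclideanSpace ℝ (Fin m) → EuclideanSpace ℝ (Fin m))),
      (iteratedFDeriv ℝ q.length (f a) y fun i => (q.get i).2 y) =
        iteratedFDeriv ℝ (q.map fun p => p.2 y).length (f a) y (q.map fun p => p.2 y).get := by
    intro q
    have hlen : (q.map fun p => p.2 y).length = q.length := List.length_map _
    generalize hq : (q.map fun p => p.2 y) = r at *
    have hr : ∀ i : Fin q.length, (q.get i).2 y = r.get (i.cast hlen.symm) := by
      intro i; subst hq; simp
    simp only [hr]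
    clear hr hq
    generalize q.length = n at *
    subst hlen
    rfl
  rw [elemDiff, DecoratedTree.fold_graft]
  change iteratedFDeriv ℝ _ (f a) y _ = _
  rw [key]
  refine iteratedFDeriv_perm (hf a) ?_ y
  have h2 : List.Perm (Multiset.map (fun t => (t, elemDiff f t))
      (l : Multiset (DecoratedTree d))).toList (l.map fun t => (t, elemDiff f t)) := by
    rw [← Multiset.coe_eq_coe, Multiset.coe_toList]; rfl
  refine (h2.map fun p => p.2 y).trans ?_
  rw [List.map_map]
  exact List.Perm.refl _

/-- The elementary differential of a linear form `φ` on the algebra of forests. The form is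
identified with `∑ φ(τ) / S(τ) τ`, as in the pairing `⟨τ, σ⟩ = δ_{τ,σ} S(τ)`, and the
elementary differential vanishes on forests which are not trees. -/
noncomputable def elemDiffDual
    (f : Fin d → EuclideanSpace ℝ (Fin m) → EuclideanSpace ℝ (Fin m))
    (φ : Module.Dual ℝ (ForestAlgebra d)) (y : EuclideanSpace ℝ (Fin m)) :
    EuclideanSpace ℝ (Fin m) :=
  ∑ᶠ t : DecoratedTree d, (φ (MvPolynomial.X t) / t.symmFactor) • elemDiff f t y

/-- The B-series over trees, truncated at `N` vertices. -/
noncomputable def treeSeries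
    (f : Fin d → EuclideanSpace ℝ (Fin m) → EuclideanSpace ℝ (Fin m)) (N : ℕ)
    (y : EuclideanSpace ℝ (Fin m)) (φ : Module.Dual ℝ (ForestAlgebra d)) :
    EuclideanSpace ℝ (Fin m) :=
  y + ∑ t ∈ DecoratedTree.upTo d N, (φ (MvPolynomial.X t) / t.symmFactor) • elemDiff f t y

end ElementaryDifferentials

/-! ### Hopf algebras with cocycles, rough paths and controlled rough paths -/

section Hopf

variable {d m : ℕ} {H : Type*} [CommRing H] [HopfAlgebra ℝ H]

/-- The submodules `𝒜 n` are a grading of the Hopf algebra `H`, with `𝒜 0 = ℝ 1`. -/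
structure IsConnectedGrading (𝒜 : ℕ → Submodule ℝ H) : Prop where
  isInternal : DirectSum.IsInternal 𝒜
  mul_mem : ∀ {i j : ℕ} {x y : H}, x ∈ 𝒜 i → y ∈ 𝒜 j → x * y ∈ 𝒜 (i + j)
  comul_mem : ∀ (n : ℕ), ∀ x ∈ 𝒜 n, (Coalgebra.comul x : H ⊗[ℝ] H) ∈
    ⨆ (i : ℕ) (j : ℕ) (_ : i + j = n),
      LinearMap.range (TensorProduct.map (𝒜 i).subtype (𝒜 j).subtype)
  counit_eq_zero : ∀ (n : ℕ), n ≠ 0 → ∀ x ∈ 𝒜 n, (Coalgebra.counit x : ℝ) = 0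
  antipode_mem : ∀ (n : ℕ), ∀ x ∈ 𝒜 n, HopfAlgebra.antipode ℝ x ∈ 𝒜 n
  zero_eq : 𝒜 0 = Submodule.span ℝ {1}

/-- The linear maps `L_a` are cocycles, homogeneous of degree one, the elements `L_a(1)` are a
basis of the part of degree one, and the `L_a` are compatible with the symmetric pairing `B`. -/
structure IsCocycleFamily (𝒜 : ℕ → Submodule ℝ H) (B : LinearMap.BilinForm ℝ H)
    (L : Fin d → H →ₗ[ℝ] H) : Prop where
  map_mem : ∀ (a : Fin d) (n : ℕ), ∀ x ∈ 𝒜 n, L a x ∈ 𝒜 (n + 1)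
  cocycle : ∀ (a : Fin d) (x : H), (Coalgebra.comul (L a x) : H ⊗[ℝ] H) =
    (L a).lTensor H (Coalgebra.comul x) + L a x ⊗ₜ[ℝ] 1
  linearIndependent : LinearIndependent ℝ fun a => L a 1
  span_eq : Submodule.span ℝ (Set.range fun a => L a 1) = 𝒜 1
  pairing_symm : ∀ x y : H, B x y = B y x
  pairing_map : ∀ (a b : Fin d) (x y : H), B (L a x) (L b y) = if a = b then B x y else 0

/-- `S` is an orthogonal basis of the submodule `I`, made of homogeneous elements with
`⟨h, h⟩ ≠ 0` and containing `1`. -/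
structure IsOrthogonalHomogeneousBasis (𝒜 : ℕ → Submodule ℝ H) (B : LinearMap.BilinForm ℝ H)
    (I : Submodule ℝ H) (S : Set H) : Prop where
  one_mem : (1 : H) ∈ S
  homogeneous : ∀ h ∈ S, ∃ n, h ∈ 𝒜 n
  orthogonal : ∀ h ∈ S, ∀ g ∈ S, h ≠ g → B h g = 0
  self_ne_zero : ∀ h ∈ S, B h h ≠ 0
  linearIndependent : LinearIndepOn ℝ id S
  span_eq : Submodule.span ℝ S = I

/-- The elements of `S` of degree smaller than `N`. -/
def degreeLT (𝒜 : ℕ → Submodule ℝ H) (S : Set H) (N : ℕ) : Set H :=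
  {h | h ∈ S ∧ ∃ n < N, h ∈ 𝒜 n}

theorem IsConnectedGrading.mem_span_inter {𝒜 : ℕ → Submodule ℝ H} (h𝒜 : IsConnectedGrading 𝒜)
    {Q : Set H} (hQ : ∀ q ∈ Q, ∃ n, q ∈ 𝒜 n) {n : ℕ} {x : H} (hx : x ∈ Submodule.span ℝ Q)
    (hxn : x ∈ 𝒜 n) : x ∈ Submodule.span ℝ {q | q ∈ Q ∧ q ∈ 𝒜 n} := by
  classical
  let := h𝒜.isInternal.chooseDecomposition
  have key : ∀ z ∈ Submodule.span ℝ Q,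
      ((DirectSum.decompose 𝒜 z n : 𝒜 n) : H) ∈ Submodule.span ℝ {q | q ∈ Q ∧ q ∈ 𝒜 n} := by
    intro z hz
    induction hz using Submodule.span_induction with
    | mem q hq =>
      obtain ⟨k, hk⟩ := hQ q hq
      by_cases hkn : k = n
      · subst hkn
        rw [DirectSum.decompose_of_mem_same 𝒜 hk]
        exact Submodule.subset_span ⟨hq, hk⟩
      · rw [DirectSum.decompose_of_mem_ne 𝒜 hk hkn]
        exact Submodule.zero_mem _
    | zero => simp
    | add a b _ _ ha hb => simpa using Submodule.add_mem _ ha hb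
    | smul c a _ ha =>
      rw [DirectSum.decompose_smul]
      exact Submodule.smul_mem _ c ha
  simpa [DirectSum.decompose_of_mem_same 𝒜 hxn] using key x hx

theorem IsConnectedGrading.eq_of_mem {𝒜 : ℕ → Submodule ℝ H} (h𝒜 : IsConnectedGrading 𝒜)
    {i j : ℕ} {x : H} (hi : x ∈ 𝒜 i) (hj : x ∈ 𝒜 j) (hx : x ≠ 0) : i = j := by
  classical
  by_contra hij
  let := h𝒜.isInternal.chooseDecomposition
  have h1 := DirectSum.decompose_of_mem_same 𝒜 hi
  rw [DirectSum.decompose_of_mem_ne 𝒜 hj (Ne.symm hij)] at h1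
  exact hx h1.symm

theorem IsConnectedGrading.prod_mem {𝒜 : ℕ → Submodule ℝ H} (h𝒜 : IsConnectedGrading 𝒜)
    (v : DecoratedTree d → H) (s : Multiset (DecoratedTree d))
    (h : ∀ t ∈ s, v t ∈ 𝒜 t.order) :
    (s.map v).prod ∈ 𝒜 (s.map DecoratedTree.order).sum := by
  induction s using Multiset.induction_on with
  | empty => simp [h𝒜.zero_eq]
  | cons t s ih =>
    rw [Multiset.map_cons, Multiset.map_cons, Multiset.prod_cons, Multiset.sum_cons]
    exact h𝒜.mul_mem (h t (Multiset.mem_cons_self _ _))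
      (ih fun u hu => h u (Multiset.mem_cons_of_mem hu))

theorem IsCocycleFamily.universalMap_X_mem {𝒜 : ℕ → Submodule ℝ H}
    {B : LinearMap.BilinForm ℝ H} {L : Fin d → H →ₗ[ℝ] H} (hL : IsCocycleFamily 𝒜 B L)
    (h𝒜 : IsConnectedGrading 𝒜) (t : DecoratedTree d) :
    universalMap L (MvPolynomial.X t) ∈ 𝒜 t.order := by
  refine DecoratedTree.induction
    (P := fun t => universalMap L (MvPolynomial.X t) ∈ 𝒜 t.order) ?_ t
  intro a s ih
  rw [universalMap, MvPolynomial.aeval_X, DecoratedTree.fold_graft, Multiset.map_map,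
    DecoratedTree.order_graft, add_comm]
  refine hL.map_mem a _ _ (h𝒜.prod_mem _ s fun t ht => ?_)
  have := ih t ht
  rwa [universalMap, MvPolynomial.aeval_X] at this

/-- There are only finitely many basis elements of degree smaller than `N`. -/
theorem IsOrthogonalHomogeneousBasis.finite_degreeLT {𝒜 : ℕ → Submodule ℝ H}
    {B : LinearMap.BilinForm ℝ H} {L : Fin d → H →ₗ[ℝ] H} {S : Set H}
    (h𝒜 : IsConnectedGrading 𝒜) (hL : IsCocycleFamily 𝒜 B L)
    (hS : IsOrthogonalHomogeneousBasis 𝒜 B (LinearMap.range (universalMap L).toLinearMap) S)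
    (N : ℕ) : (degreeLT 𝒜 S N).Finite := by
  classical
  let v : DecoratedTree d → H := fun t => universalMap L (MvPolynomial.X t)
  let F : Set (Multiset (DecoratedTree d)) := {s | (s.map DecoratedTree.order).sum ≤ N}
  have hF : F.Finite := DecoratedTree.finite_forest_of_finite (DecoratedTree.finite_order_le d N)
  let Q : Set H := Set.range fun s : Multiset (DecoratedTree d) => (s.map v).prod
  have hv : ∀ s : Multiset (DecoratedTree d), (s.map v).prod ∈ 𝒜 (s.map DecoratedTree.order).sum :=
    fun s => h𝒜.prod_mem v s fun t _ => hL.universalMap_X_mem h𝒜 t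
  have hrange : LinearMap.range (universalMap L).toLinearMap ≤ Submodule.span ℝ Q := by
    rintro _ ⟨p, rfl⟩
    induction p using MvPolynomial.induction_on' with
    | monomial s c =>
      change universalMap L (MvPolynomial.monomial s c) ∈ _
      have hm : universalMap L (MvPolynomial.monomial s c) =
          c • ∏ t ∈ s.support, v t ^ s t := by
        rw [MvPolynomial.monomial_eq, map_mul, MvPolynomial.algHom_C, ← Algebra.smul_def]
        simp only [Finsupp.prod, map_prod, map_pow, v]
      rw [hm]
      refine Submodule.smul_mem _ _ (Submodule.subset_span ⟨Finsupp.toMultiset s, ?_⟩)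
      change ((Finsupp.toMultiset s).map v).prod = _
      rw [Finsupp.toMultiset_map, Finsupp.prod_toMultiset,
        Finsupp.prod_mapDomain_index (by simp) (by intros; rw [pow_add])]
      rfl
    | add p q hp hq => rw [map_add]; exact Submodule.add_mem _ hp hq
  have hsub : degreeLT 𝒜 S N ⊆
      (Submodule.span ℝ ((fun s : Multiset (DecoratedTree d) => (s.map v).prod) '' F) : Set H) := by
    rintro h ⟨hh, n, hn, hhn⟩
    have h0 : h ∈ Submodule.span ℝ Q :=
      hrange (hS.span_eq ▸ Submodule.subset_span hh)
    have h1 := h𝒜.mem_span_inter (by rintro _ ⟨s, rfl⟩; exact ⟨_, hv s⟩) h0 hhn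
    refine Submodule.span_le.2 ?_ h1
    rintro _ ⟨⟨s, rfl⟩, hs⟩
    by_cases hz : (s.map v).prod = 0
    · change (s.map v).prod ∈ _
      rw [hz]; exact Submodule.zero_mem _
    · refine Submodule.subset_span ⟨s, ?_, rfl⟩
      have := h𝒜.eq_of_mem (hv s) hs hz
      change (s.map DecoratedTree.order).sum ≤ N
      omega
  have : FiniteDimensional ℝ
      (Submodule.span ℝ ((fun s : Multiset (DecoratedTree d) => (s.map v).prod) '' F)) :=
    FiniteDimensional.span_of_finite ℝ (hF.image _)
  have hli : LinearIndepOn ℝ id (degreeLT 𝒜 S N) := hS.linearIndependent.mono fun h hh => hh.1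
  have hli' : LinearIndependent ℝ fun h : degreeLT 𝒜 S N =>
      (⟨h.1, hsub h.2⟩ : Submodule.span ℝ
        ((fun s : Multiset (DecoratedTree d) => (s.map v).prod) '' F)) :=
    LinearIndependent.of_comp (Submodule.subtype _) hli
  have := hli'.finite
  exact Set.toFinite _

/-- A basis element of degree `n` pairs to zero with the image of every tree whose number of
vertices is not `n`. -/
theorem IsOrthogonalHomogeneousBasis.pairing_tree_eq_zero {𝒜 : ℕ → Submodule ℝ H}
    {B : LinearMap.BilinForm ℝ H} {L : Fin d → H →ₗ[ℝ] H} {S : Set H}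
    (h𝒜 : IsConnectedGrading 𝒜) (hL : IsCocycleFamily 𝒜 B L)
    (hS : IsOrthogonalHomogeneousBasis 𝒜 B (LinearMap.range (universalMap L).toLinearMap) S)
    {h : H} (hh : h ∈ S) {n : ℕ} (hn : h ∈ 𝒜 n) (t : DecoratedTree d) (ht : t.order ≠ n) :
    B h (universalMap L (MvPolynomial.X t)) = 0 := by
  have h0 : universalMap L (MvPolynomial.X t) ∈ Submodule.span ℝ S := by
    rw [hS.span_eq]; exact ⟨_, rfl⟩
  have h1 := h𝒜.mem_span_inter hS.homogeneous h0 (hL.universalMap_X_mem h𝒜 t)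
  have h2 : Submodule.span ℝ {q | q ∈ S ∧ q ∈ 𝒜 t.order} ≤ LinearMap.ker (B h) := by
    refine Submodule.span_le.2 ?_
    rintro g ⟨hg, hgt⟩
    refine hS.orthogonal h hh g hg ?_
    rintro rfl
    exact ht (h𝒜.eq_of_mem hgt hn fun h0 => hS.self_ne_zero h hh (by simp [h0]))
  exact h2 h1

/-- The product of linear forms dual to the coproduct. -/
noncomputable def dualMul (φ ψ : Module.Dual ℝ H) : Module.Dual ℝ H :=
  LinearMap.mul' ℝ ℝ ∘ₗ TensorProduct.map φ ψ ∘ₗ Coalgebra.comul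

/-- The linear form `⟨h, ·⟩ / ⟨h, h⟩`. For `h` in an orthogonal basis of a subspace, its value at
an element of this subspace is the coefficient of `h`. -/
noncomputable def normalizedDual (B : LinearMap.BilinForm ℝ H) (h : H) : Module.Dual ℝ H :=
  (B h h)⁻¹ • B h

/-- The `ℝ^m`-valued coefficient of `h` of an element of `H^m`. -/
noncomputable def coeffAt (B : LinearMap.BilinForm ℝ H) (h : H) (w : Fin m → H) :
    EuclideanSpace ℝ (Fin m) :=
  WithLp.toLp 2 fun i => normalizedDual B h (w i)

/-- Rough paths of regularity `γ` on `[0, T]` over a graded Hopf algebra. -/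
structure IsRoughPath (𝒜 : ℕ → Submodule ℝ H) (γ T : ℝ) (X : ℝ → ℝ → H →ₐ[ℝ] ℝ) : Prop where
  chen : ∀ s r t : ℝ, 0 ≤ s → s ≤ r → r ≤ t → t ≤ T →
    (X s t).toLinearMap = dualMul (X s r).toLinearMap (X r t).toLinearMap
  holder : ∀ (n : ℕ), ∀ h ∈ 𝒜 n, ∃ C : ℝ, ∀ s ∈ Set.Icc 0 T, ∀ t ∈ Set.Icc 0 T, s ≠ t →
    |X s t h| ≤ C * |t - s| ^ (γ * n)

/-- The elementary differential of `h ∈ H`: the linear form `⟨h, ·⟩` on `H` is pulled back along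
`Λ` to the algebra of forests. -/
noncomputable def elemDiffBar (B : LinearMap.BilinForm ℝ H) (L : Fin d → H →ₗ[ℝ] H)
    (f : Fin d → EuclideanSpace ℝ (Fin m) → EuclideanSpace ℝ (Fin m)) (h : H)
    (y : EuclideanSpace ℝ (Fin m)) : EuclideanSpace ℝ (Fin m) :=
  elemDiffDual f ((universalMap L).toLinearMap.dualMap (B h)) y

/-- `Y` solves `dY = ∑_a f_a(Y) dX^a` on `[0, T]`, in the sense of Davie: on short intervals
`Y_t` agrees with the B-series at `Y_s` driven by `X_{s,t}`, truncated at degree `N`, up to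
`o(t - s)`, uniformly. -/
def IsCocycleRDESolution (L : Fin d → H →ₗ[ℝ] H)
    (f : Fin d → EuclideanSpace ℝ (Fin m) → EuclideanSpace ℝ (Fin m)) (N : ℕ) (T : ℝ)
    (X : ℝ → ℝ → H →ₐ[ℝ] ℝ) (Y : ℝ → EuclideanSpace ℝ (Fin m)) : Prop :=
  ∀ ε > 0, ∃ δ > 0, ∀ s t : ℝ, 0 ≤ s → s ≤ t → t ≤ T → t - s < δ →
    ‖Y t - treeSeries f N (Y s)
      ((universalMap L).toLinearMap.dualMap (X s t).toLinearMap)‖ ≤ ε * (t - s)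

/-- Controlled rough paths with respect to the orthogonal basis `S`, where `N` is the largest
integer with `N γ ≤ 1`. -/
structure IsControlledRoughPath (𝒜 : ℕ → Submodule ℝ H) (B : LinearMap.BilinForm ℝ H)
    (S : Set H) (γ : ℝ) (N : ℕ) (T : ℝ) (X : ℝ → ℝ → H →ₐ[ℝ] ℝ) (W : ℝ → Fin m → H) :
    Prop where
  remainder_one : ∃ C : ℝ, ∀ s t : ℝ, 0 ≤ s → s ≤ t → t ≤ T →
    ‖coeffAt B 1 (W t) - (coeffAt B 1 (W s) +
      ∑ᶠ h ∈ degreeLT 𝒜 S N \ {1}, X s t h • coeffAt B h (W s))‖ ≤ C * |t - s| ^ (N * γ)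
  remainder : ∀ n < N, ∀ h ∈ S, h ∈ 𝒜 n → ∃ C : ℝ, ∀ s t : ℝ, 0 ≤ s → s ≤ t → t ≤ T →
    ‖coeffAt B h (W t) - ∑ᶠ g ∈ degreeLT 𝒜 S N,
      dualMul (X s t).toLinearMap (normalizedDual B h) g • coeffAt B g (W s)‖ ≤
        C * |t - s| ^ (((N : ℝ) - n) * γ)
  mem_span : ∀ t ∈ Set.Icc 0 T, ∀ i, W t i ∈ Submodule.span ℝ S

/-- The `H^m`-valued path with coefficient `Y_t` at `1` and coefficient
`elemDiffBar h (Y_t) / ⟨h, h⟩` at the other elements `h` of `S` of degree smaller than `M`. -/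
noncomputable def elemDiffPath (𝒜 : ℕ → Submodule ℝ H) (B : LinearMap.BilinForm ℝ H)
    (L : Fin d → H →ₗ[ℝ] H) (S : Set H)
    (f : Fin d → EuclideanSpace ℝ (Fin m) → EuclideanSpace ℝ (Fin m)) (M : ℕ)
    (Y : ℝ → EuclideanSpace ℝ (Fin m)) (t : ℝ) (i : Fin m) : H :=
  Y t i • (1 : H) +
    ∑ᶠ h ∈ degreeLT 𝒜 S M \ {1}, (elemDiffBar B L f h (Y t) i / B h h) • h

end Hopf

-- Write `λ = (t - s)^γ`; every estimate is uniform over the pairs `s < t` in `[0, T]`, which is the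
-- meaning of `=O[⊤]`. Pulled back along `Λ`, the rough path becomes a character `φ = X_{s,t} ∘ Λ`
-- of the forest algebra with `φ(τ) = O(λ^|τ|)`, and Davie's condition says that `Y_t` is the
-- B-series of `φ` at `Y_s` up to `O(λ^N)`. What must be shown is the composition law of B-series
-- with a remainder: `Υ[u](Y_t) / S(u)` equals the sum over `|τ| ≤ n` of `c_u(τ) / S(τ) · Υ[τ](Y_s)`
-- up to `R_u = O(λ^(n+1-|u|))`, where `c_u(τ)` is the coefficient of the tree `u` in `(φ ⊗ id)Δτ`
-- (`translate`).
--
-- A generating function replaces the combinatorics of iterated chain rules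
-- (`isBigO_elemDiffRemainder`, by induction on `n`). Perturb `Y_t` by the sum of `x_u Υ[u](Y_t) /
-- S(u)` with `x_u = λ^|u| ξ_u` and `ξ` arbitrary, and compare with the B-series at `Y_s` of the
-- convolution of `φ` with the character `x`. The translate of a tree is affine (`translate_X_eq`),
-- so the two points differ by Davie's error, a tail of high order and the sum of the `x_u R_u`, all
-- `O(λ^(n+1))` by induction. As `f_a` is locally Lipschitz, its values at the two points are
-- equally close. Taylor's formula indexed by forests (`exists_norm_sub_forestTaylor_le`) expands
-- both values, and the coefficient of the monomial `ξ^G` in the difference is `λ^|G|` times the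
-- remainder of the tree `B_+^a(G)` (`forestTaylor_sub_forestTaylor`). A polynomial in `ξ` which is
-- `O(λ^(n+1))` for each `ξ` has coefficients of that size (`isBigO_coeff_of_forall_eval`), and the
-- root accounts for one more power of `λ`.
--
-- To return to the Hopf algebra: the cocycle identity makes `Λ` intertwine the two translations
-- (`universalMap_translate`), and orthogonality turns sums over trees into sums over the basis
-- (`sum_upTo_eq_sum_degreeLT`). A basis element of degree `n` pairs only with trees having `n`
-- vertices, which gives its exponent `(N - n)γ`.

/-! ### Iterated directional derivatives along a family of vectors -/

section DirectionalDerivatives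

variable {m : ℕ} {ι : Type*}

/-- The iterated derivative of `g` at `y` in the directions `w i`, for `i` in a multiset. -/
noncomputable def dirDeriv (g : EuclideanSpace ℝ (Fin m) → EuclideanSpace ℝ (Fin m))
    (w : ι → EuclideanSpace ℝ (Fin m)) (s : Multiset ι) (y : EuclideanSpace ℝ (Fin m)) :
    EuclideanSpace ℝ (Fin m) :=
  iteratedFDeriv ℝ (s.toList.map w).length g y (s.toList.map w).get

variable {g : EuclideanSpace ℝ (Fin m) → EuclideanSpace ℝ (Fin m)}

/-- Symmetry of higher derivatives makes the arbitrary order chosen by `toList` irrelevant. -/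
theorem dirDeriv_coe (hg : ContDiff ℝ ∞ g) (w : ι → EuclideanSpace ℝ (Fin m)) (l : List ι)
    (y : EuclideanSpace ℝ (Fin m)) :
    dirDeriv g w (l : Multiset ι) y =
      iteratedFDeriv ℝ (l.map w).length g y (l.map w).get :=
  iteratedFDeriv_perm hg ((Multiset.coe_eq_coe.1 (Multiset.coe_toList _)).map w) y

theorem dirDeriv_zero (w : ι → EuclideanSpace ℝ (Fin m)) (y : EuclideanSpace ℝ (Fin m)) :
    dirDeriv g w 0 y = g y := by
  have h : ∀ l : List (EuclideanSpace ℝ (Fin m)), l = [] →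
      iteratedFDeriv ℝ l.length g y l.get = g y := by
    rintro _ rfl
    exact iteratedFDeriv_zero_apply _
  exact h _ (by simp)

/-- The directions are frozen vectors that do not vary with the base point, so one more derivative
adds one direction and produces no product-rule terms. -/
theorem dirDeriv_cons (hg : ContDiff ℝ ∞ g) (w : ι → EuclideanSpace ℝ (Fin m)) (i : ι)
    (s : Multiset ι) (y : EuclideanSpace ℝ (Fin m)) :
    dirDeriv g w (i ::ₘ s) y = fderiv ℝ (dirDeriv g w s) y (w i) := by
  induction s using Quotient.inductionOn with
  | h l =>
    change dirDeriv g w ((i :: l : List ι) : Multiset ι) y =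
      fderiv ℝ (dirDeriv g w (l : Multiset ι)) y (w i)
    rw [dirDeriv_coe hg, funext (dirDeriv_coe hg w l)]
    exact iteratedFDeriv_cons hg _ _ _

theorem contDiff_dirDeriv (hg : ContDiff ℝ ∞ g) (w : ι → EuclideanSpace ℝ (Fin m))
    (s : Multiset ι) : ContDiff ℝ ∞ (dirDeriv g w s) := by
  have h1 : ContDiff ℝ ∞ (iteratedFDeriv ℝ (s.toList.map w).length g) :=
    hg.iteratedFDeriv_right (m := ∞) (by exact_mod_cast le_top)
  exact (ContinuousMultilinearMap.apply ℝ
    (fun _ : Fin (s.toList.map w).length => EuclideanSpace ℝ (Fin m))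
    (EuclideanSpace ℝ (Fin m)) (s.toList.map w).get).contDiff.comp h1

/-- Compactness of a ball. The constant depends on the directions only through their number and the
bound on their size, which gives uniformity in the time parameters. -/
theorem exists_norm_dirDeriv_le (hg : ContDiff ℝ ∞ g) (n : ℕ) (R R' : ℝ) :
    ∃ C, 0 ≤ C ∧ ∀ (w : ι → EuclideanSpace ℝ (Fin m)) (s : Multiset ι), s.card = n →
      (∀ i ∈ s, ‖w i‖ ≤ R) → ∀ y, ‖y‖ ≤ R' → ‖dirDeriv g w s y‖ ≤ C := by
  have hc : Continuous (iteratedFDeriv ℝ n g) :=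
    hg.continuous_iteratedFDeriv (by exact_mod_cast le_top)
  obtain ⟨C, hC⟩ := (isCompact_closedBall (0 : EuclideanSpace ℝ (Fin m)) R').exists_bound_of_continuousOn
    hc.continuousOn
  refine ⟨|C| * |R| ^ n, by positivity, fun w s hs hw y hy => ?_⟩
  have hl : (s.toList.map w).length = n := by simpa using hs
  have key : ∀ (l : List (EuclideanSpace ℝ (Fin m))), l.length = n → (∀ v ∈ l, ‖v‖ ≤ R) →
      ‖iteratedFDeriv ℝ l.length g y l.get‖ ≤ |C| * |R| ^ n := by
    rintro l rfl hv
    refine (ContinuousMultilinearMap.le_opNorm _ _).trans ?_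
    refine mul_le_mul ((hC y (by simpa using hy)).trans (le_abs_self C)) ?_ (by positivity)
      (by positivity)
    refine (Finset.prod_le_prod (fun _ _ => norm_nonneg _) fun i _ =>
      (hv _ (List.get_mem l i)).trans (le_abs_self R)).trans ?_
    simp
  refine key _ hl fun v hv => ?_
  obtain ⟨i, hi, rfl⟩ := List.mem_map.1 hv
  exact hw i (Multiset.mem_toList.1 hi)

end DirectionalDerivatives

/-! ### Multiset factorials -/

section MultFactorial

variable {ι : Type*}

open Classical in
/-- The product of the factorials of the multiplicities of a multiset. -/
noncomputable def multFactorial (s : Multiset ι) : ℝ := ∏ i ∈ s.toFinset, ((s.count i).factorial : ℝ)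

theorem multFactorial_zero : multFactorial (0 : Multiset ι) = 1 := by simp [multFactorial]

theorem multFactorial_pos (s : Multiset ι) : 0 < multFactorial s :=
  Finset.prod_pos fun _ _ => by positivity

open Classical in
theorem multFactorial_cons (i : ι) (s : Multiset ι) :
    multFactorial (i ::ₘ s) = (i ::ₘ s).count i * multFactorial s := by
  have h : multFactorial s = ∏ j ∈ insert i s.toFinset, ((s.count j).factorial : ℝ) := by
    refine Finset.prod_subset (Finset.subset_insert _ _) fun j _ hj => ?_
    rw [Multiset.count_eq_zero_of_notMem (by simpa using hj)]
    simp
  rw [h, multFactorial, Multiset.toFinset_cons, Finset.prod_eq_mul_prod_sdiff_singleton_of_mem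
    (Finset.mem_insert_self _ _), Finset.prod_eq_mul_prod_sdiff_singleton_of_mem
    (Finset.mem_insert_self i s.toFinset), ← mul_assoc]
  congr 1
  · rw [Multiset.count_cons_self, Nat.factorial_succ]
    push_cast
    ring
  · refine Finset.prod_congr rfl fun j hj => ?_
    rw [Multiset.count_cons_of_ne]
    simpa using (Finset.mem_sdiff.1 hj).2

end MultFactorial

/-! ### A Taylor formula indexed by forests -/

section Taylor

variable {d m : ℕ}

namespace DecoratedTree

theorem mem_upTo {N : ℕ} {t : DecoratedTree d} : t ∈ upTo d N ↔ t.order ≤ N := by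
  simp [upTo]

/-- The number of vertices of a forest. -/
def forestOrder (F : Multiset (DecoratedTree d)) : ℕ := (F.map order).sum

theorem forestOrder_zero : forestOrder (0 : Multiset (DecoratedTree d)) = 0 := by
  simp [forestOrder]

theorem forestOrder_cons (t : DecoratedTree d) (F : Multiset (DecoratedTree d)) :
    forestOrder (t ::ₘ F) = t.order + forestOrder F := by
  simp [forestOrder]

theorem forestOrder_add (F G : Multiset (DecoratedTree d)) :
    forestOrder (F + G) = forestOrder F + forestOrder G := by
  simp [forestOrder]

theorem order_le_forestOrder {t : DecoratedTree d} {F : Multiset (DecoratedTree d)} (h : t ∈ F) :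
    t.order ≤ forestOrder F := by
  obtain ⟨G, rfl⟩ := Multiset.exists_cons_of_mem h
  rw [forestOrder_cons]
  omega

theorem finite_forestOrder_lt (d N : ℕ) :
    {F : Multiset (DecoratedTree d) | forestOrder F < N}.Finite :=
  (finite_forest_of_finite (finite_order_le d N)).subset fun F (h : forestOrder F < N) => (h.le : (F.map order).sum ≤ N)

/-- The finite set of the forests with less than `N` vertices. -/
noncomputable def forestsLT (d N : ℕ) : Finset (Multiset (DecoratedTree d)) :=
  (finite_forestOrder_lt d N).toFinset

theorem mem_forestsLT {N : ℕ} {F : Multiset (DecoratedTree d)} :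
    F ∈ forestsLT d N ↔ forestOrder F < N := by
  simp [forestsLT]

open Classical in
theorem forestOrder_eq_sum_count {n : ℕ} {F : Multiset (DecoratedTree d)}
    (hF : ∀ t ∈ F, t ∈ upTo d n) :
    forestOrder F = ∑ t ∈ upTo d n, F.count t * t.order := by
  rw [forestOrder, Finset.sum_multiset_map_count]
  refine Finset.sum_subset (fun t ht => hF t (by simpa using ht)) fun t _ ht => ?_
  rw [Multiset.count_eq_zero_of_notMem (by simpa using ht)]
  simp

-- Remove one copy of `t`: the multiplicity cancels one factor of the factorial, and forests without
-- `t` contribute nothing. If `t` has at least `k` vertices, the subtraction truncates to `0` and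
-- both sides vanish.
open Classical in
theorem sum_forestsLT_count_smul {V : Type*} [AddCommGroup V] [Module ℝ V] (k : ℕ)
    (t : DecoratedTree d) (A : Multiset (DecoratedTree d) → V) :
    ∑ F ∈ forestsLT d k, ((F.count t : ℝ) * (multFactorial F)⁻¹) • A F =
      ∑ F ∈ forestsLT d (k - t.order), (multFactorial F)⁻¹ • A (t ::ₘ F) := by
  have hinj : Function.Injective fun F : Multiset (DecoratedTree d) => t ::ₘ F :=
    fun _ _ h => (Multiset.cons_inj_right t).1 h
  have hsub : (forestsLT d (k - t.order)).image (fun F => t ::ₘ F) ⊆ forestsLT d k := by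
    intro F hF
    obtain ⟨G, hG, rfl⟩ := Finset.mem_image.1 hF
    rw [mem_forestsLT] at hG ⊢
    rw [forestOrder_cons]
    omega
  rw [← Finset.sum_subset hsub, Finset.sum_image hinj.injOn]
  · refine Finset.sum_congr rfl fun F _ => ?_
    have h0 : (((t ::ₘ F).count t : ℕ) : ℝ) ≠ 0 := by
      rw [Multiset.count_cons_self]; positivity
    rw [multFactorial_cons, mul_inv, ← mul_assoc, mul_inv_cancel₀ h0, one_mul]
  · intro F hF hF'
    have : t ∉ F := by
      intro ht
      obtain ⟨G, rfl⟩ := Multiset.exists_cons_of_mem ht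
      refine hF' (Finset.mem_image.2 ⟨G, ?_, rfl⟩)
      rw [mem_forestsLT] at hF ⊢
      rw [forestOrder_cons] at hF
      omega
    rw [Multiset.count_eq_zero_of_notMem this]
    simp

/-- Euler's relation for weighted-homogeneous series: the weight of a forest is the sum over trees
of multiplicity times order. The bound on `k` ensures that every tree occurring in such a forest
lies in `upTo d n`. -/
theorem sum_forestsLT_order_smul {V : Type*} [AddCommGroup V] [Module ℝ V] {n k : ℕ}
    (hk : k ≤ n + 1) (A : Multiset (DecoratedTree d) → V) :
    ∑ F ∈ forestsLT d k, ((forestOrder F : ℝ) * (multFactorial F)⁻¹) • A F =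
      ∑ t ∈ upTo d n, (t.order : ℝ) •
        ∑ F ∈ forestsLT d (k - t.order), (multFactorial F)⁻¹ • A (t ::ₘ F) := by
  classical
  simp_rw [← sum_forestsLT_count_smul, Finset.smul_sum]
  rw [Finset.sum_comm]
  refine Finset.sum_congr rfl fun F hF => ?_
  rw [mem_forestsLT] at hF
  rw [forestOrder_eq_sum_count (n := n) fun t ht => mem_upTo.2 (by
    have := order_le_forestOrder ht; omega)]
  push_cast
  rw [Finset.sum_mul, Finset.sum_smul]
  refine Finset.sum_congr rfl fun t _ => ?_
  rw [smul_smul]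
  congr 1
  ring

end DecoratedTree

open DecoratedTree

/-- The part of the Taylor series of `dirDeriv g w G` at `y` made of the forests with less than
`k` vertices, where `x` are the coordinates with respect to the family `w`. -/
noncomputable def forestTaylor (g : EuclideanSpace ℝ (Fin m) → EuclideanSpace ℝ (Fin m))
    (w : DecoratedTree d → EuclideanSpace ℝ (Fin m)) (x : DecoratedTree d → ℝ)
    (G : Multiset (DecoratedTree d)) (k : ℕ) (y : EuclideanSpace ℝ (Fin m)) :
    EuclideanSpace ℝ (Fin m) :=
  ∑ F ∈ forestsLT d k, (multFactorial F)⁻¹ • (F.map x).prod • dirDeriv g w (F + G) y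

theorem map_prod_scale (θ : ℝ) (x : DecoratedTree d → ℝ) (F : Multiset (DecoratedTree d)) :
    (F.map fun t => θ ^ t.order * x t).prod = θ ^ forestOrder F * (F.map x).prod := by
  induction F using Multiset.induction_on with
  | empty => simp [forestOrder_zero]
  | cons t F ih => simp only [Multiset.map_cons, Multiset.prod_cons, ih, forestOrder_cons]; ring

variable {g : EuclideanSpace ℝ (Fin m) → EuclideanSpace ℝ (Fin m)}

/-- The derivative along the weighted dilation `x_t ↦ θ^|t| x_t` is made of the same truncated
series with `t` moved into the differentiated directions. It has exactly the shape of
`hasDerivAt_dirDeriv_scale`, so the Taylor remainder satisfies a recursion in `k`. -/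
theorem hasDerivAt_forestTaylor (w : DecoratedTree d → EuclideanSpace ℝ (Fin m))
    (x : DecoratedTree d → ℝ) (G : Multiset (DecoratedTree d)) {n k : ℕ} (hk : k ≤ n + 1)
    (y : EuclideanSpace ℝ (Fin m)) (θ : ℝ) :
    HasDerivAt (fun θ : ℝ => forestTaylor g w (fun t => θ ^ t.order * x t) G k y)
      (∑ t ∈ upTo d n, (t.order * θ ^ (t.order - 1) * x t) •
        forestTaylor g w (fun t => θ ^ t.order * x t) (t ::ₘ G) (k - t.order) y) θ := by
  simp only [forestTaylor, map_prod_scale]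
  have h1 : HasDerivAt (fun θ : ℝ => ∑ F ∈ forestsLT d k, (multFactorial F)⁻¹ •
      (θ ^ forestOrder F * (F.map x).prod) • dirDeriv g w (F + G) y)
      (∑ F ∈ forestsLT d k, (multFactorial F)⁻¹ •
        ((forestOrder F * θ ^ (forestOrder F - 1)) * (F.map x).prod) •
          dirDeriv g w (F + G) y) θ := by
    refine HasDerivAt.fun_sum fun F _ => ?_
    exact (((hasDerivAt_pow (forestOrder F) θ).mul_const ((F.map x).prod)).smul_const
      (dirDeriv g w (F + G) y)).const_smul (multFactorial F)⁻¹
  refine h1.congr_deriv ?_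
  have h2 := sum_forestsLT_order_smul hk fun F : Multiset (DecoratedTree d) =>
    (θ ^ (forestOrder F - 1) * (F.map x).prod) • dirDeriv g w (F + G) y
  refine Eq.trans (Finset.sum_congr rfl fun F _ => ?_) (h2.trans ?_)
  · simp only [smul_smul]; congr 1; ring
  · refine Finset.sum_congr rfl fun t _ => ?_
    rw [Finset.smul_sum, Finset.smul_sum]
    refine Finset.sum_congr rfl fun F _ => ?_
    have h3 : forestOrder (t ::ₘ F) - 1 = (t.order - 1) + forestOrder F := by
      have := one_le_order t
      rw [forestOrder_cons]; omega
    rw [h3, Multiset.map_cons, Multiset.prod_cons, Multiset.add_cons, Multiset.cons_add]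
    simp only [smul_smul]
    congr 1
    ring

theorem hasDerivAt_dirDeriv_scale (hg : ContDiff ℝ ∞ g)
    (w : DecoratedTree d → EuclideanSpace ℝ (Fin m))
    (x : DecoratedTree d → ℝ) (G : Multiset (DecoratedTree d)) (n : ℕ)
    (y : EuclideanSpace ℝ (Fin m)) (θ : ℝ) :
    HasDerivAt (fun θ : ℝ => dirDeriv g w G (y + ∑ t ∈ upTo d n, (θ ^ t.order * x t) • w t))
      (∑ t ∈ upTo d n, (t.order * θ ^ (t.order - 1) * x t) •
        dirDeriv g w (t ::ₘ G) (y + ∑ t ∈ upTo d n, (θ ^ t.order * x t) • w t)) θ := by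
  have h1 : HasDerivAt (fun θ : ℝ => y + ∑ t ∈ upTo d n, (θ ^ t.order * x t) • w t)
      (∑ t ∈ upTo d n, (t.order * θ ^ (t.order - 1) * x t) • w t) θ := by
    refine HasDerivAt.const_add _ (HasDerivAt.fun_sum fun t _ => ?_)
    exact ((hasDerivAt_pow _ θ).mul_const _).smul_const _
  have h2 := ((contDiff_dirDeriv hg w G).differentiable (by simp)
    (y + ∑ t ∈ upTo d n, (θ ^ t.order * x t) • w t)).hasFDerivAt
  refine (h2.comp_hasDerivAt θ h1).congr_deriv ?_
  rw [map_sum]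
  refine Finset.sum_congr rfl fun t _ => ?_
  rw [map_smul, dirDeriv_cons hg]

/-- Only the empty forest survives, and it is present because `k ≠ 0`; for `k = 0` the series is the
empty sum. -/
theorem forestTaylor_of_forall_eq_zero (w : DecoratedTree d → EuclideanSpace ℝ (Fin m))
    (x : DecoratedTree d → ℝ) (hx : ∀ t, x t = 0) (G : Multiset (DecoratedTree d)) {k : ℕ}
    (hk : k ≠ 0) (y : EuclideanSpace ℝ (Fin m)) : forestTaylor g w x G k y = dirDeriv g w G y := by
  rw [forestTaylor, Finset.sum_eq_single 0]
  · simp [multFactorial_zero]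
  · intro F _ hF
    obtain ⟨t, ht⟩ := Multiset.exists_mem_of_ne_zero hF
    rw [Multiset.prod_eq_zero (Multiset.mem_map.2 ⟨t, ht, hx t⟩)]
    simp
  · intro h
    exact absurd (mem_forestsLT.2 (by rw [forestOrder_zero]; omega)) h

/-- Taylor's formula with a remainder of weighted order `k`. -/
theorem exists_norm_sub_forestTaylor_le (hg : ContDiff ℝ ∞ g) (n : ℕ) (R : ℝ) (hR : 1 ≤ R) :
    ∀ k ≤ n + 1, ∀ G : Multiset (DecoratedTree d), (∀ t ∈ G, t.order ≤ n) →
      ∃ C, 0 ≤ C ∧ ∀ (y : EuclideanSpace ℝ (Fin m))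
        (w : DecoratedTree d → EuclideanSpace ℝ (Fin m))
        (x : DecoratedTree d → ℝ) (lam : ℝ), ‖y‖ ≤ R → (∀ t, t.order ≤ n → ‖w t‖ ≤ R) →
        0 ≤ lam → lam ≤ R → (∀ t, t.order ≤ n → |x t| ≤ R * lam ^ t.order) →
        ‖dirDeriv g w G (y + ∑ t ∈ upTo d n, x t • w t) - forestTaylor g w x G k y‖ ≤
          C * lam ^ k := by
  intro k
  induction k using Nat.strong_induction_on with
  | _ k ih =>
  intro hk G hG
  -- For `k = 0` the series is empty and the claim is boundedness on a large ball, whose radius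
  -- bounds `y` plus the whole perturbation.
  rcases Nat.eq_zero_or_pos k with rfl | hkpos
  · obtain ⟨C, hC0, hC⟩ := exists_norm_dirDeriv_le (ι := DecoratedTree d) hg G.card R
      (R + ∑ t ∈ upTo d n, R * R ^ t.order * R)
    refine ⟨C, hC0, fun y w x lam hy hw hl hl' hx => ?_⟩
    have h0 : forestTaylor g w x G 0 y = 0 := by
      have : forestsLT d 0 = ∅ := by
        ext F; simp [mem_forestsLT]
      simp [forestTaylor, this]
    rw [h0, sub_zero, pow_zero, mul_one]
    refine hC w G rfl (fun t ht => hw t (hG t ht)) _ ?_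
    refine (norm_add_le _ _).trans (add_le_add hy ((norm_sum_le _ _).trans ?_))
    refine Finset.sum_le_sum fun t ht => ?_
    rw [norm_smul, Real.norm_eq_abs]
    have ht' := mem_upTo.1 ht
    refine mul_le_mul ((hx t ht').trans ?_) (hw t ht') (norm_nonneg _) (by positivity)
    gcongr
  · have hchoice : ∀ t : DecoratedTree d, ∃ C, t.order ≤ n → 0 ≤ C ∧
        ∀ (y : EuclideanSpace ℝ (Fin m)) (w : DecoratedTree d → EuclideanSpace ℝ (Fin m))
        (x : DecoratedTree d → ℝ) (lam : ℝ), ‖y‖ ≤ R → (∀ t, t.order ≤ n → ‖w t‖ ≤ R) →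
        0 ≤ lam → lam ≤ R → (∀ t, t.order ≤ n → |x t| ≤ R * lam ^ t.order) →
        ‖dirDeriv g w (t ::ₘ G) (y + ∑ t ∈ upTo d n, x t • w t) -
          forestTaylor g w x (t ::ₘ G) (k - t.order) y‖ ≤ C * lam ^ (k - t.order) := by
      intro t
      by_cases ht : t.order ≤ n
      · have h1 := one_le_order t
        obtain ⟨C, hC⟩ := ih (k - t.order) (by omega) (by omega) (t ::ₘ G) (by
          intro u hu
          rcases Multiset.mem_cons.1 hu with rfl | hu
          · exact ht
          · exact hG u hu)
        exact ⟨C, fun _ => hC⟩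
      · exact ⟨0, fun h => absurd h ht⟩
    choose C hC using hchoice
    refine ⟨∑ t ∈ upTo d n, t.order * R * (C t * R ^ t.order),
      Finset.sum_nonneg fun t ht => ?_, fun y w x lam hy hw hl hl' hx => ?_⟩
    · have := (hC t (mem_upTo.1 ht)).1
      positivity
    -- The remainder vanishes at `θ = 0`, and its `θ`-derivative is a combination of remainders of
    -- order `k - |t|`. The mean value inequality on `[0, 1]` then gives order `k`.
    have hderiv := fun θ : ℝ => (hasDerivAt_dirDeriv_scale hg w x G n y θ).sub
      (hasDerivAt_forestTaylor (g := g) w x G hk y θ)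
    have hmv := norm_image_sub_le_of_norm_deriv_le_segment_01'
      (C := (∑ t ∈ upTo d n, t.order * R * (C t * R ^ t.order)) * lam ^ k)
      (fun θ _ => (hderiv θ).hasDerivWithinAt) ?_
    · have hz : ∀ t : DecoratedTree d, (0 : ℝ) ^ t.order = 0 := fun t =>
        zero_pow (by have := one_le_order t; omega)
      simp only [Pi.sub_apply, one_pow, one_mul, hz, zero_mul, zero_smul, Finset.sum_const_zero,
        add_zero] at hmv
      rw [forestTaylor_of_forall_eq_zero w (fun _ => 0) (fun _ => rfl) G (by omega), sub_self,
        sub_zero] at hmv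
      exact hmv
    · intro θ hθ
      rw [← Finset.sum_sub_distrib, Finset.sum_mul]
      refine (norm_sum_le _ _).trans (Finset.sum_le_sum fun t ht => ?_)
      have ht' := mem_upTo.1 ht
      obtain ⟨hC0, hC1⟩ := hC t ht'
      rw [← smul_sub, norm_smul]
      have hscale : ∀ u : DecoratedTree d, u.order ≤ n → |θ ^ u.order * x u| ≤ R * lam ^ u.order := by
        intro u hu
        rw [abs_mul, abs_of_nonneg (pow_nonneg hθ.1 _)]
        exact (mul_le_of_le_one_left (abs_nonneg _) (pow_le_one₀ hθ.1 hθ.2.le)).trans (hx u hu)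
      have h1 := hC1 y w (fun u => θ ^ u.order * x u) lam hy hw hl hl' hscale
      have h2 : ‖(t.order : ℝ) * θ ^ (t.order - 1) * x t‖ ≤ t.order * R * lam ^ t.order := by
        rw [norm_mul, norm_mul, Real.norm_natCast, norm_pow, Real.norm_of_nonneg hθ.1,
          Real.norm_eq_abs, mul_assoc, mul_assoc]
        refine mul_le_mul_of_nonneg_left ?_ (Nat.cast_nonneg _)
        exact (mul_le_of_le_one_left (abs_nonneg _) (pow_le_one₀ hθ.1 hθ.2.le)).trans (hx t ht')
      -- If `|t| > k`, the truncated difference leaves the surplus `lam ^ (|t| - k)`, which is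
      -- bounded by a power of `R ≥ 1`.
      have h3 : lam ^ t.order * lam ^ (k - t.order) ≤ R ^ t.order * lam ^ k := by
        have : lam ^ t.order * lam ^ (k - t.order) = lam ^ (t.order - k) * lam ^ k := by
          rw [← pow_add, ← pow_add]; congr 1; omega
        rw [this]
        refine mul_le_mul_of_nonneg_right ?_ (pow_nonneg hl _)
        exact (pow_le_pow_left₀ hl hl' _).trans (pow_le_pow_right₀ hR (by omega))
      calc _ ≤ (t.order * R * lam ^ t.order) * (C t * lam ^ (k - t.order)) :=
            mul_le_mul h2 h1 (norm_nonneg _) (by positivity)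
        _ = t.order * R * C t * (lam ^ t.order * lam ^ (k - t.order)) := by ring
        _ ≤ t.order * R * C t * (R ^ t.order * lam ^ k) := by gcongr
        _ = _ := by ring

end Taylor

/-! ### Coefficients of polynomials indexed by multisets -/

section Extraction

variable {ι : Type*}

theorem eval_monomial_toFinsupp [DecidableEq ι] {A : Type*} [CommSemiring A] [Algebra ℝ A]
    (x : ι → A) (F : Multiset ι) (c : ℝ) :
    MvPolynomial.aeval x (MvPolynomial.monomial (Multiset.toFinsupp F) c) =
      c • (F.map x).prod := by
  rw [MvPolynomial.aeval_monomial, ← Algebra.smul_def]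
  congr 1
  conv_rhs => rw [← Multiset.toFinsupp_toMultiset F]
  rw [Finsupp.toMultiset_map, Finsupp.prod_toMultiset,
    Finsupp.prod_mapDomain_index (by simp) (by intros; rw [pow_add])]

/-- Evaluations of the monomials in `K` span `ℝ^K`: a linear form vanishing on all of them is the
coefficient vector of a polynomial which is zero at every point, hence zero. So a finite combination
of evaluations isolates the coefficient of `F₀`. -/
theorem exists_interpolation (K : Finset (Multiset ι)) {F₀ : Multiset ι} (hF₀ : F₀ ∈ K) :
    ∃ c : (ι → ℝ) →₀ ℝ, (c.sum fun ξ a => a * (F₀.map ξ).prod) = 1 ∧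
      ∀ F ∈ K, F ≠ F₀ → (c.sum fun ξ a => a * (F.map ξ).prod) = 0 := by
  classical
  let v : (ι → ℝ) → (K → ℝ) := fun ξ F => (F.1.map ξ).prod
  have hspan : Submodule.span ℝ (Set.range v) = ⊤ := by
    by_contra hne
    obtain ⟨f, hf, hker⟩ := Submodule.exists_le_ker_of_lt_top _ (lt_top_iff_ne_top.2 hne)
    have hfc : ∀ u : K → ℝ, f u = ∑ F, u F * f (Pi.single F 1) := by
      intro u
      conv_lhs => rw [pi_eq_sum_univ' u]
      rw [map_sum]
      refine Finset.sum_congr rfl fun F _ => ?_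
      rw [map_smul, smul_eq_mul]
    let q : MvPolynomial ι ℝ :=
      ∑ F : K, MvPolynomial.monomial (Multiset.toFinsupp F.1) (f (Pi.single F 1))
    have hq : q = 0 := by
      refine MvPolynomial.funext fun ξ => ?_
      rw [map_zero, ← MvPolynomial.coe_aeval_eq_eval, RingHom.coe_coe]
      simp only [q, map_sum, eval_monomial_toFinsupp]
      have := hker (Submodule.subset_span ⟨ξ, rfl⟩)
      rw [LinearMap.mem_ker, hfc] at this
      rw [← this]
      exact Finset.sum_congr rfl fun F _ => mul_comm _ _
    refine hf (LinearMap.ext fun u => ?_)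
    rw [hfc, LinearMap.zero_apply]
    refine Finset.sum_eq_zero fun G _ => ?_
    have h1 : MvPolynomial.coeff (Multiset.toFinsupp G.1) q = f (Pi.single G 1) := by
      simp only [q, MvPolynomial.coeff_sum, MvPolynomial.coeff_monomial]
      rw [Finset.sum_eq_single G]
      · simp
      · intro F _ hFG
        rw [if_neg]
        intro h
        exact hFG (Subtype.ext (Multiset.toFinsupp.injective h))
      · simp
    rw [← h1, hq, MvPolynomial.coeff_zero, mul_zero]
  have hmem : Pi.single ⟨F₀, hF₀⟩ 1 ∈ Submodule.span ℝ (Set.range v) := by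
    rw [hspan]; trivial
  obtain ⟨c, hc⟩ := Finsupp.mem_span_range_iff_exists_finsupp.1 hmem
  have key : ∀ F : K, (c.sum fun ξ a => a * (F.1.map ξ).prod) =
      (Pi.single ⟨F₀, hF₀⟩ 1 : K → ℝ) F := by
    intro F
    rw [← hc, Finsupp.sum, Finsupp.sum, Finset.sum_apply]
    rfl
  refine ⟨c, ?_, fun F hF hne => ?_⟩
  · rw [key ⟨F₀, hF₀⟩, Pi.single_eq_same]
  · rw [key ⟨F, hF⟩, Pi.single_eq_of_ne]
    exact fun h => hne (congrArg Subtype.val h)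

/-- If all values of a polynomial depending on a parameter are `O(g)`, then so are its
coefficients. -/
theorem isBigO_coeff_of_forall_eval {P E : Type*} [NormedAddCommGroup E] [NormedSpace ℝ E]
    {l : Filter P} {g : P → ℝ} (K : Finset (Multiset ι)) (a : Multiset ι → P → E)
    (h : ∀ ξ : ι → ℝ, (fun p => ∑ F ∈ K, (F.map ξ).prod • a F p) =O[l] g)
    {F₀ : Multiset ι} (hF₀ : F₀ ∈ K) : a F₀ =O[l] g := by
  classical
  obtain ⟨c, hc1, hc0⟩ := exists_interpolation K hF₀
  have h1 : (fun p => ∑ ξ ∈ c.support, c ξ • ∑ F ∈ K, (F.map ξ).prod • a F p) =O[l] g :=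
    Asymptotics.IsBigO.fun_sum fun ξ _ => (h ξ).const_smul_left (c ξ)
  refine h1.congr_left fun p => ?_
  simp only [Finset.smul_sum]
  rw [Finset.sum_comm]
  have h2 : ∀ F : Multiset ι, ∑ ξ ∈ c.support, c ξ • (F.map ξ).prod • a F p =
      (c.sum fun ξ a => a * (F.map ξ).prod) • a F p := by
    intro F
    rw [Finsupp.sum, Finset.sum_smul]
    exact Finset.sum_congr rfl fun ξ _ => smul_smul _ _ _
  simp only [h2]
  rw [Finset.sum_eq_single F₀ (fun F hF hne => by rw [hc0 F hF hne, zero_smul])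
    (fun h => absurd hF₀ h), hc1, one_smul]

end Extraction

/-! ### Translation of forests by a character -/

section Translation

variable {d : ℕ}

open DecoratedTree

namespace ForestAlgebra

open Classical in
/-- The coefficient of a forest. -/
noncomputable def forestCoeff (F : Multiset (DecoratedTree d)) : ForestAlgebra d →ₗ[ℝ] ℝ :=
  MvPolynomial.lcoeff ℝ (Multiset.toFinsupp F)

open Classical in
theorem forestCoeff_apply (F : Multiset (DecoratedTree d)) (q : ForestAlgebra d) :
    forestCoeff F q = MvPolynomial.coeff (Multiset.toFinsupp F) q := rfl

open Classical in
theorem coeff_eq_forestCoeff (s : DecoratedTree d →₀ ℕ) (q : ForestAlgebra d) :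
    MvPolynomial.coeff s q = forestCoeff (Finsupp.toMultiset s) q := by
  rw [forestCoeff_apply, Finsupp.toMultiset_toFinsupp]

open Classical in
theorem forestCoeff_monomial (F : Multiset (DecoratedTree d)) (s : DecoratedTree d →₀ ℕ) (c : ℝ) :
    forestCoeff F (MvPolynomial.monomial s c) = if F = Finsupp.toMultiset s then c else 0 := by
  rw [forestCoeff_apply, MvPolynomial.coeff_monomial]
  congr 1
  refine propext ⟨fun h => ?_, fun h => ?_⟩
  · rw [h, Multiset.toFinsupp_toMultiset]
  · rw [h, Finsupp.toMultiset_toFinsupp]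

theorem forestCoeff_one_zero : forestCoeff (0 : Multiset (DecoratedTree d)) 1 = 1 := by
  simp [forestCoeff_apply]

theorem forestCoeff_C {F : Multiset (DecoratedTree d)} (hF : F ≠ 0) (c : ℝ) :
    forestCoeff F (MvPolynomial.C c) = 0 := by
  classical
  rw [MvPolynomial.C_apply, forestCoeff_monomial, if_neg (by simpa using hF)]

theorem graft_monomial (a : Fin d) (s : DecoratedTree d →₀ ℕ) (c : ℝ) :
    graft a (MvPolynomial.monomial s c) =
      MvPolynomial.monomial (Finsupp.single (DecoratedTree.graft a (Finsupp.toMultiset s)) 1) c := by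
  have h := (MvPolynomial.basisMonomials (DecoratedTree d) ℝ).constr_basis ℝ
    (fun s => (MvPolynomial.X (DecoratedTree.graft a (Finsupp.toMultiset s)) : ForestAlgebra d)) s
  rw [MvPolynomial.coe_basisMonomials] at h
  have hc : ∀ u : DecoratedTree d →₀ ℕ,
      (MvPolynomial.monomial u c : ForestAlgebra d) = c • MvPolynomial.monomial u 1 := by
    intro u; rw [MvPolynomial.smul_monomial, smul_eq_mul, mul_one]
  rw [hc, map_smul, hc]
  congr 1

theorem graft_prod_X (a : Fin d) (F : Multiset (DecoratedTree d)) :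
    graft a (F.map MvPolynomial.X).prod = MvPolynomial.X (DecoratedTree.graft a F) := by
  classical
  have h := eval_monomial_toFinsupp (MvPolynomial.X : DecoratedTree d → ForestAlgebra d) F 1
  rw [one_smul, MvPolynomial.aeval_X_left, AlgHom.id_apply] at h
  rw [← h, graft_monomial, Multiset.toFinsupp_toMultiset, MvPolynomial.X]

/-- Root and branches are read off by a fold that ignores the recursive values. -/
theorem _root_.DecoratedTree.graft_injective {a b : Fin d} {F G : Multiset (DecoratedTree d)}
    (h : DecoratedTree.graft a F = DecoratedTree.graft b G) : a = b ∧ F = G := by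
  have h2 := congrArg (fold (β := Fin d × Multiset (DecoratedTree d))
    fun a s => (a, s.map Prod.fst)) h
  rw [fold_graft, fold_graft] at h2
  simpa only [Multiset.map_map, Prod.mk.injEq, Function.comp_def, Multiset.map_id'] using h2

theorem forestCoeff_singleton_graft (a b : Fin d) (F : Multiset (DecoratedTree d))
    (q : ForestAlgebra d) :
    forestCoeff {DecoratedTree.graft b F} (graft a q) = if a = b then forestCoeff F q else 0 := by
  classical
  induction q using MvPolynomial.induction_on' with
  | monomial s c =>
    rw [graft_monomial, forestCoeff_monomial, forestCoeff_monomial, Finsupp.toMultiset_single,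
      one_smul]
    by_cases hab : a = b
    · subst hab
      rw [if_pos rfl]
      congr 1
      refine propext ⟨fun h => ?_, fun h => by rw [h]⟩
      exact (DecoratedTree.graft_injective (Multiset.singleton_inj.1 h)).2
    · rw [if_neg hab, if_neg]
      intro h
      exact hab (DecoratedTree.graft_injective (Multiset.singleton_inj.1 h)).1.symm
  | add p q hp hq =>
    rw [map_add, map_add, hp, hq, map_add]
    split_ifs <;> simp

theorem forestCoeff_graft_of_card_ne {F : Multiset (DecoratedTree d)} (hF : F.card ≠ 1)
    (a : Fin d) (q : ForestAlgebra d) : forestCoeff F (graft a q) = 0 := by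
  classical
  induction q using MvPolynomial.induction_on' with
  | monomial s c =>
    rw [graft_monomial, forestCoeff_monomial, if_neg]
    rintro rfl
    simp at hF
  | add p q hp hq => rw [map_add, map_add, hp, hq, add_zero]

/-- The index set is the same for all factors, so it can be fixed before a family of polynomials is
estimated. -/
theorem exists_forestCoeff_mul (F : Multiset (DecoratedTree d)) :
    ∃ K : Finset (Multiset (DecoratedTree d) × Multiset (DecoratedTree d)),
      (∀ x ∈ K, x.1 + x.2 = F) ∧
      ∀ p q : ForestAlgebra d, forestCoeff F (p * q) =
        ∑ x ∈ K, forestCoeff x.1 p * forestCoeff x.2 q := by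
  classical
  refine ⟨(Finset.HasAntidiagonal.antidiagonal (Multiset.toFinsupp F)).image fun x =>
    (Finsupp.toMultiset x.1, Finsupp.toMultiset x.2), ?_, fun p q => ?_⟩
  · rintro _ hy
    obtain ⟨x, hx, rfl⟩ := Finset.mem_image.1 hy
    rw [Finset.HasAntidiagonal.mem_antidiagonal] at hx
    change Finsupp.toMultiset x.1 + Finsupp.toMultiset x.2 = F
    rw [← map_add, hx, Multiset.toFinsupp_toMultiset]
  · rw [Finset.sum_image, forestCoeff_apply, MvPolynomial.coeff_mul]
    · simp only [coeff_eq_forestCoeff]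
    · intro x _ y _ h
      have h1 := congrArg Prod.fst h
      have h2 := congrArg Prod.snd h
      exact Prod.ext (Multiset.toFinsupp.symm.injective h1) (Multiset.toFinsupp.symm.injective h2)

theorem eq_sum_forestCoeff {k : ℕ} {q : ForestAlgebra d}
    (hq : ∀ F, k ≤ forestOrder F → forestCoeff F q = 0) :
    q = ∑ F ∈ forestsLT d k, forestCoeff F q • (F.map MvPolynomial.X).prod := by
  classical
  have hm : ∀ (F : Multiset (DecoratedTree d)) (c : ℝ),
      c • (F.map (MvPolynomial.X : DecoratedTree d → ForestAlgebra d)).prod =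
        MvPolynomial.monomial (Multiset.toFinsupp F) c := by
    intro F c
    have h := eval_monomial_toFinsupp (MvPolynomial.X : DecoratedTree d → ForestAlgebra d) F c
    rw [MvPolynomial.aeval_X_left, AlgHom.id_apply] at h
    exact h.symm
  simp only [hm]
  refine MvPolynomial.ext _ _ fun s => ?_
  rw [coeff_eq_forestCoeff, coeff_eq_forestCoeff, map_sum]
  simp only [forestCoeff_monomial, Multiset.toFinsupp_toMultiset]
  rw [Finset.sum_ite_eq]
  split_ifs with h
  · rfl
  · refine hq _ ?_
    rw [mem_forestsLT] at h
    omega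

theorem map_eq_sum_forestCoeff {A : Type*} [CommRing A] [Algebra ℝ A] (ψ : ForestAlgebra d →ₐ[ℝ] A)
    {k : ℕ} {q : ForestAlgebra d} (hq : ∀ F, k ≤ forestOrder F → forestCoeff F q = 0) :
    ψ q = ∑ F ∈ forestsLT d k, forestCoeff F q • (F.map fun t => ψ (MvPolynomial.X t)).prod := by
  conv_lhs => rw [eq_sum_forestCoeff hq]
  rw [map_sum]
  refine Finset.sum_congr rfl fun F _ => ?_
  rw [map_smul, map_multiset_prod, Multiset.map_map]
  rfl

/-- The algebra morphism `(φ ⊗ id) ∘ Δ` of the forest algebra, where `Δ` is the coproduct whose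
right factors contain the root. -/
noncomputable def translate (φ : ForestAlgebra d →ₐ[ℝ] ℝ) : ForestAlgebra d →ₐ[ℝ] ForestAlgebra d :=
  MvPolynomial.aeval (DecoratedTree.fold fun a s => graft a (s.map Prod.snd).prod +
    MvPolynomial.C (φ (MvPolynomial.X (DecoratedTree.graft a (s.map Prod.fst)))))

/-- The image of a forest under `translate`. -/
noncomputable def translateForest (φ : ForestAlgebra d →ₐ[ℝ] ℝ) (F : Multiset (DecoratedTree d)) :
    ForestAlgebra d :=
  (F.map fun t => translate φ (MvPolynomial.X t)).prod

/-- This is the cocycle identity of `B_+^a` with `φ` applied to the left factor; it determines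
`translate` recursively, so the coproduct on forests need not be constructed. -/
theorem translate_X_graft (φ : ForestAlgebra d →ₐ[ℝ] ℝ) (a : Fin d)
    (F : Multiset (DecoratedTree d)) :
    translate φ (MvPolynomial.X (DecoratedTree.graft a F)) =
      graft a (translateForest φ F) +
        MvPolynomial.C (φ (MvPolynomial.X (DecoratedTree.graft a F))) := by
  rw [translate, MvPolynomial.aeval_X, fold_graft, Multiset.map_map, Multiset.map_map]
  simp only [Function.comp_def, Multiset.map_id', translateForest, translate, MvPolynomial.aeval_X]

/-- Grafting is injective, so extracting a tree amounts to comparing roots and extracting the forest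
above it. This links the remainders of `B_+^a(G)` with Taylor coefficients at `G`. -/
theorem forestCoeff_translate_graft (φ : ForestAlgebra d →ₐ[ℝ] ℝ) (a b : Fin d)
    (F G : Multiset (DecoratedTree d)) :
    forestCoeff {DecoratedTree.graft b G}
      (translate φ (MvPolynomial.X (DecoratedTree.graft a F))) =
        if a = b then forestCoeff G (translateForest φ F) else 0 := by
  rw [translate_X_graft, map_add, forestCoeff_singleton_graft, forestCoeff_C (by simp), add_zero]

end ForestAlgebra

end Translation

-- Weighted size of the coefficients of translated forests

section WeightedBigO

variable {d : ℕ} {P : Type*}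

open DecoratedTree ForestAlgebra Asymptotics

/-- A family of polynomials of weighted degree at most `n` whose part of weighted degree `k` is
`O(lam ^ (n - k))`, in the form which makes sense if `lam` vanishes. -/
def IsWeightedBigO (lam : P → ℝ) (n : ℕ) (q : P → ForestAlgebra d) : Prop :=
  ∀ F, (n < forestOrder F → ∀ p, forestCoeff F (q p) = 0) ∧
    (fun p => forestCoeff F (q p) * lam p ^ forestOrder F) =O[⊤] fun p => lam p ^ n

variable {lam : P → ℝ}

theorem IsWeightedBigO.one : IsWeightedBigO (d := d) lam 0 fun _ => 1 := by
  intro F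
  rcases eq_or_ne F 0 with rfl | hF
  · refine ⟨fun h => absurd h (by simp [forestOrder_zero]), ?_⟩
    simp only [forestCoeff_one_zero, forestOrder_zero, one_mul]
    exact isBigO_refl _ _
  · have h0 : forestCoeff F (1 : ForestAlgebra d) = 0 := by
      rw [← MvPolynomial.C_1, forestCoeff_C hF]
    refine ⟨fun _ _ => h0, ?_⟩
    simp only [h0, zero_mul]
    exact isBigO_zero _ _

theorem IsWeightedBigO.mul {n k : ℕ} {q r : P → ForestAlgebra d} (hq : IsWeightedBigO lam n q)
    (hr : IsWeightedBigO lam k r) : IsWeightedBigO lam (n + k) fun p => q p * r p := by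
  intro F
  obtain ⟨K, hK, hmul⟩ := exists_forestCoeff_mul F
  refine ⟨fun h p => ?_, ?_⟩
  · rw [hmul]
    refine Finset.sum_eq_zero fun x hx => ?_
    rw [← hK x hx, forestOrder_add] at h
    rcases lt_or_ge n (forestOrder x.1) with h1 | h1
    · rw [(hq x.1).1 h1, zero_mul]
    · rw [(hr x.2).1 (by omega), mul_zero]
  · simp only [hmul, Finset.sum_mul]
    refine IsBigO.fun_sum fun x hx => ?_
    refine (((hq x.1).2.mul (hr x.2).2).congr_left fun p => ?_).congr_right fun p => ?_
    · rw [← hK x hx, forestOrder_add]; ring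
    · rw [pow_add]

theorem IsWeightedBigO.multiset_prod {q : DecoratedTree d → P → ForestAlgebra d}
    (F : Multiset (DecoratedTree d)) (hq : ∀ t ∈ F, IsWeightedBigO lam t.order (q t)) :
    IsWeightedBigO lam (forestOrder F) fun p => (F.map fun t => q t p).prod := by
  induction F using Multiset.induction_on with
  | empty => simpa [forestOrder_zero] using IsWeightedBigO.one
  | cons t F ih =>
    simp only [Multiset.map_cons, Multiset.prod_cons, forestOrder_cons]
    exact (hq t (Multiset.mem_cons_self _ _)).mul
      (ih fun u hu => hq u (Multiset.mem_cons_of_mem hu))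

theorem IsWeightedBigO.graft_add_C {n : ℕ} {q : P → ForestAlgebra d}
    (hq : IsWeightedBigO lam n q) (a : Fin d) {c : P → ℝ}
    (hc : c =O[⊤] fun p => lam p ^ (n + 1)) :
    IsWeightedBigO lam (n + 1) fun p => ForestAlgebra.graft a (q p) + MvPolynomial.C (c p) := by
  intro F
  rcases eq_or_ne F 0 with rfl | hF
  · refine ⟨fun h => absurd h (by simp [forestOrder_zero]), ?_⟩
    have h1 : ∀ p, forestCoeff (0 : Multiset (DecoratedTree d))
        (ForestAlgebra.graft a (q p) + MvPolynomial.C (c p)) = c p := by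
      intro p
      rw [map_add, forestCoeff_graft_of_card_ne (by simp), zero_add]
      simp [forestCoeff_apply]
    simp only [h1, forestOrder_zero, pow_zero, mul_one]
    exact hc
  · simp only [map_add, forestCoeff_C hF, add_zero]
    by_cases hcard : F.card = 1
    · obtain ⟨t, rfl⟩ := Multiset.card_eq_one.1 hcard
      refine DecoratedTree.induction (P := fun t => (n + 1 < forestOrder {t} →
        ∀ p, forestCoeff {t} (ForestAlgebra.graft a (q p)) = 0) ∧
        (fun p => forestCoeff {t} (ForestAlgebra.graft a (q p)) * lam p ^ forestOrder {t})
          =O[⊤] fun p => lam p ^ (n + 1)) (fun b G _ => ?_) t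
      have ho : forestOrder {DecoratedTree.graft b G} = forestOrder G + 1 := by
        rw [forestOrder, Multiset.map_singleton, Multiset.sum_singleton, order_graft, add_comm]
        rfl
      simp only [ho, forestCoeff_singleton_graft]
      split_ifs with hab
      · refine ⟨fun h p => (hq G).1 (by omega) p, ?_⟩
        simp only [pow_succ, ← mul_assoc]
        exact (hq G).2.mul (isBigO_refl _ _)
      · simp only [zero_mul]
        exact ⟨fun _ _ => by simp, isBigO_zero _ _⟩
    · simp only [forestCoeff_graft_of_card_ne hcard, zero_mul]
      exact ⟨fun _ _ => by simp, isBigO_zero _ _⟩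

/-- The quantitative form of the grading of the coproduct: if the right factor keeps `k` vertices,
`φ` receives the other `|t| - k`. Induction over trees, since grafting and the constant term both
raise the weight by one. -/
theorem isWeightedBigO_translate {φ : P → ForestAlgebra d →ₐ[ℝ] ℝ}
    (hφ : ∀ t, (fun p => φ p (MvPolynomial.X t)) =O[⊤] fun p => lam p ^ t.order)
    (t : DecoratedTree d) :
    IsWeightedBigO lam t.order fun p => translate (φ p) (MvPolynomial.X t) := by
  refine DecoratedTree.induction (P := fun t => IsWeightedBigO lam t.order
    fun p => translate (φ p) (MvPolynomial.X t)) (fun a F ih => ?_) t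
  have ho : (DecoratedTree.graft a F).order = forestOrder F + 1 := by
    rw [order_graft, add_comm]; rfl
  have h := hφ (DecoratedTree.graft a F)
  simp only [translate_X_graft]
  rw [ho] at h ⊢
  exact (IsWeightedBigO.multiset_prod F ih).graft_add_C a h

theorem isWeightedBigO_translateForest {φ : P → ForestAlgebra d →ₐ[ℝ] ℝ}
    (hφ : ∀ t, (fun p => φ p (MvPolynomial.X t)) =O[⊤] fun p => lam p ^ t.order)
    (F : Multiset (DecoratedTree d)) :
    IsWeightedBigO lam (forestOrder F) fun p => translateForest (φ p) F :=
  IsWeightedBigO.multiset_prod F fun t _ => isWeightedBigO_translate hφ t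

/-- Under the dilated evaluation, each forest supplies the power of `lam` missing from its
coefficient. -/
theorem isWeightedBigO_eval {n : ℕ} {q : P → ForestAlgebra d}
    (hq : IsWeightedBigO lam n q) (ξ : DecoratedTree d → ℝ) :
    (fun p => MvPolynomial.aeval (fun t => lam p ^ t.order * ξ t) (q p)) =O[⊤]
      fun p => lam p ^ n := by
  have h1 : ∀ p, MvPolynomial.aeval (fun t => lam p ^ t.order * ξ t) (q p) =
      ∑ F ∈ forestsLT d (n + 1), (F.map ξ).prod * (forestCoeff F (q p) * lam p ^ forestOrder F) := by
    intro p
    rw [map_eq_sum_forestCoeff (k := n + 1) _ fun F hF => (hq F).1 (by omega) p]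
    refine Finset.sum_congr rfl fun F _ => ?_
    simp only [MvPolynomial.aeval_X, smul_eq_mul]
    rw [map_prod_scale]
    ring
  simp only [h1]
  exact IsBigO.fun_sum fun F _ => (hq F).2.const_mul_left _

/-- The degree half of `IsWeightedBigO`, read off with a one-point parameter space and scale `1`. -/
theorem forestCoeff_translate_eq_zero (φ : ForestAlgebra d →ₐ[ℝ] ℝ) {t : DecoratedTree d}
    {F : Multiset (DecoratedTree d)} (h : t.order < forestOrder F) :
    forestCoeff F (translate φ (MvPolynomial.X t)) = 0 :=
  (isWeightedBigO_translate (P := Unit) (lam := fun _ => 1) (φ := fun _ => φ) (fun t => by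
    simp only [one_pow]; exact isBigO_const_const _ one_ne_zero _) t F).1 h ()

theorem forestCoeff_translateForest_eq_zero (φ : ForestAlgebra d →ₐ[ℝ] ℝ)
    {F G : Multiset (DecoratedTree d)} (h : forestOrder F < forestOrder G) :
    forestCoeff G (translateForest φ F) = 0 :=
  (isWeightedBigO_translateForest (P := Unit) (lam := fun _ => 1) (φ := fun _ => φ) (fun t => by
    simp only [one_pow]; exact isBigO_const_const _ one_ne_zero _) F G).1 h ()

/-- The translation of a tree is an affine polynomial. -/
theorem translate_X_eq (φ : ForestAlgebra d →ₐ[ℝ] ℝ) {n : ℕ} {t : DecoratedTree d}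
    (ht : t.order ≤ n) :
    translate φ (MvPolynomial.X t) = MvPolynomial.C (φ (MvPolynomial.X t)) +
      ∑ u ∈ upTo d n, forestCoeff {u} (translate φ (MvPolynomial.X t)) • MvPolynomial.X u := by
  classical
  -- Apart from its constant, the translate is in the image of a grafting, whose monomials are
  -- single trees.
  have key : ∀ t : DecoratedTree d, ∃ a q, translate φ (MvPolynomial.X t) =
      ForestAlgebra.graft a q + MvPolynomial.C (φ (MvPolynomial.X t)) := fun t =>
    DecoratedTree.induction (P := fun t => ∃ a q, translate φ (MvPolynomial.X t) =
      ForestAlgebra.graft a q + MvPolynomial.C (φ (MvPolynomial.X t)))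
      (fun a F _ => ⟨a, _, translate_X_graft φ a F⟩) t
  obtain ⟨a, q, hq⟩ := key t
  have hc : ∀ F : Multiset (DecoratedTree d), F ≠ 0 →
      forestCoeff F (translate φ (MvPolynomial.X t)) =
        forestCoeff F (ForestAlgebra.graft a q) := by
    intro F hF
    rw [hq, map_add, forestCoeff_C hF, add_zero]
  have h0 : ∀ F, n + 1 ≤ forestOrder F → forestCoeff F (ForestAlgebra.graft a q) = 0 := by
    intro F hF
    rw [← hc F (by rintro rfl; simp [forestOrder_zero] at hF)]
    exact forestCoeff_translate_eq_zero φ (by omega)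
  conv_lhs => rw [hq, eq_sum_forestCoeff h0, add_comm]
  congr 1
  have hsub : (upTo d n).image (fun u => ({u} : Multiset (DecoratedTree d))) ⊆
      forestsLT d (n + 1) := by
    intro F hF
    obtain ⟨u, hu, rfl⟩ := Finset.mem_image.1 hF
    rw [mem_upTo] at hu
    rw [mem_forestsLT]
    simp only [forestOrder, Multiset.map_singleton, Multiset.sum_singleton]
    omega
  rw [← Finset.sum_subset hsub, Finset.sum_image fun u _ v _ h => Multiset.singleton_inj.1 h]
  · refine Finset.sum_congr rfl fun u _ => ?_
    rw [hc _ (by simp)]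
    simp
  · intro F hF hF'
    rw [forestCoeff_graft_of_card_ne, zero_smul]
    intro hcard
    obtain ⟨u, rfl⟩ := Multiset.card_eq_one.1 hcard
    refine hF' (Finset.mem_image.2 ⟨u, ?_, rfl⟩)
    rw [mem_forestsLT] at hF
    simp only [forestOrder, Multiset.map_singleton, Multiset.sum_singleton] at hF
    rw [mem_upTo]
    omega

end WeightedBigO

-- Elementary differentials and uniform Taylor estimates

section ElementaryDifferentialBounds

variable {d m : ℕ} {P : Type*}

open DecoratedTree Asymptotics

theorem symmFactor_graft_eq (a : Fin d) (F : Multiset (DecoratedTree d)) :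
    ((graft a F).symmFactor : ℝ) =
      multFactorial F * (F.map fun t => (t.symmFactor : ℝ)).prod := by
  classical
  rw [symmFactor_graft, multFactorial, Finset.prod_multiset_map_count, ← Finset.prod_mul_distrib]
  push_cast
  rfl

theorem symmFactor_pos (t : DecoratedTree d) : (0 : ℝ) < t.symmFactor := by
  refine DecoratedTree.induction (P := fun t => (0 : ℝ) < t.symmFactor) (fun a F ih => ?_) t
  rw [symmFactor_graft_eq]
  refine mul_pos (multFactorial_pos F) ?_
  refine Multiset.prod_pos fun x hx => ?_
  obtain ⟨u, hu, rfl⟩ := Multiset.mem_map.1 hx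
  exact ih u hu

variable {f : Fin d → EuclideanSpace ℝ (Fin m) → EuclideanSpace ℝ (Fin m)}

theorem dirDeriv_elemDiff (hf : ∀ a, ContDiff ℝ ∞ (f a)) (a : Fin d)
    (F : Multiset (DecoratedTree d)) (y : EuclideanSpace ℝ (Fin m)) :
    dirDeriv (f a) (fun t => elemDiff f t y) F y = elemDiff f (graft a F) y := by
  induction F using Quotient.inductionOn with
  | h l => exact (dirDeriv_coe (hf a) _ l y).trans (elemDiff_graft hf a l y).symm

/-- Since `S(B_+^a F)` is the multiset factorial of `F` times the product of the `S(τ)`, a Taylor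
series of `f_a` in the directions `Υ[τ](y)` is a B-series over the trees with root `a`. -/
theorem forestTaylor_elemDiff (hf : ∀ a, ContDiff ℝ ∞ (f a)) (a : Fin d)
    (c : DecoratedTree d → ℝ) (k : ℕ) (y : EuclideanSpace ℝ (Fin m)) :
    forestTaylor (f a) (fun t => elemDiff f t y) (fun t => c t / t.symmFactor) 0 k y =
      ∑ F ∈ forestsLT d k,
        ((F.map c).prod / (graft a F).symmFactor) • elemDiff f (graft a F) y := by
  rw [forestTaylor]
  refine Finset.sum_congr rfl fun F _ => ?_
  rw [add_zero, dirDeriv_elemDiff hf, smul_smul, symmFactor_graft_eq, Multiset.prod_map_div]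
  congr 1
  field_simp

theorem exists_norm_elemDiff_le (hf : ∀ a, ContDiff ℝ ∞ (f a)) (R : ℝ) (t : DecoratedTree d) :
    ∃ C, 0 ≤ C ∧ ∀ y, ‖y‖ ≤ R → ‖elemDiff f t y‖ ≤ C := by
  classical
  refine DecoratedTree.induction
    (P := fun t => ∃ C, 0 ≤ C ∧ ∀ y, ‖y‖ ≤ R → ‖elemDiff f t y‖ ≤ C) (fun a F ih => ?_) t
  choose! C hC0 hC using ih
  obtain ⟨C', hC'0, hC'⟩ := exists_norm_dirDeriv_le (ι := DecoratedTree d) (hf a) F.card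
    (∑ t ∈ F.toFinset, C t) R
  refine ⟨C', hC'0, fun y hy => ?_⟩
  rw [← dirDeriv_elemDiff hf]
  refine hC' _ F rfl (fun u hu => (hC u hu y hy).trans ?_) y hy
  exact Finset.single_le_sum (fun v hv => hC0 v (by simpa using hv)) (by simpa using hu)

theorem isBigO_elemDiff (hf : ∀ a, ContDiff ℝ ∞ (f a)) {y : P → EuclideanSpace ℝ (Fin m)}
    (hy : y =O[⊤] fun _ => (1 : ℝ)) (t : DecoratedTree d) :
    (fun p => elemDiff f t (y p)) =O[⊤] fun _ => (1 : ℝ) := by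
  obtain ⟨R, hR⟩ := isBigO_top.1 hy
  obtain ⟨C, -, hC⟩ := exists_norm_elemDiff_le hf R t
  exact isBigO_top.2 ⟨C, fun p => by simpa using hC _ (by simpa using hR p)⟩

/-- A smooth map is Lipschitz on a ball containing both bounded families. -/
theorem isBigO_comp_sub_comp {g : EuclideanSpace ℝ (Fin m) → EuclideanSpace ℝ (Fin m)}
    (hg : ContDiff ℝ ∞ g) {u v : P → EuclideanSpace ℝ (Fin m)}
    (hu : u =O[⊤] fun _ => (1 : ℝ)) (hv : v =O[⊤] fun _ => (1 : ℝ)) :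
    (fun p => g (u p) - g (v p)) =O[⊤] fun p => u p - v p := by
  obtain ⟨Ru, hRu⟩ := isBigO_top.1 hu
  obtain ⟨Rv, hRv⟩ := isBigO_top.1 hv
  have hc : Continuous (fderiv ℝ g) := hg.continuous_fderiv (by simp)
  obtain ⟨C, hC⟩ := (isCompact_closedBall (0 : EuclideanSpace ℝ (Fin m))
    (max Ru Rv)).exists_bound_of_continuousOn hc.continuousOn
  refine isBigO_top.2 ⟨C, fun p => ?_⟩
  refine (convex_closedBall (0 : EuclideanSpace ℝ (Fin m)) (max Ru Rv)).norm_image_sub_le_of_norm_fderiv_le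
    (𝕜 := ℝ) (fun x _ => hg.differentiable (by simp) x) hC ?_ ?_
  · have := hRv p
    simp only [norm_one, mul_one] at this
    simpa using Or.inr this
  · have := hRu p
    simp only [norm_one, mul_one] at this
    simpa using Or.inl this

/-- The Taylor estimate with all bounds collected in one constant `R`; finitely many trees matter,
so the constants of the individual directions and coordinates can be summed. -/
theorem isBigO_sub_forestTaylor {g : EuclideanSpace ℝ (Fin m) → EuclideanSpace ℝ (Fin m)}
    (hg : ContDiff ℝ ∞ g) {n : ℕ} {lam : P → ℝ} (hlam : ∀ p, 0 ≤ lam p)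
    (hlam' : lam =O[⊤] fun _ => (1 : ℝ))
    {y : P → EuclideanSpace ℝ (Fin m)} (hy : y =O[⊤] fun _ => (1 : ℝ))
    {w : P → DecoratedTree d → EuclideanSpace ℝ (Fin m)}
    (hw : ∀ t, (fun p => w p t) =O[⊤] fun _ => (1 : ℝ))
    {x : P → DecoratedTree d → ℝ}
    (hx : ∀ t, (fun p => x p t) =O[⊤] fun p => lam p ^ t.order) :
    (fun p => g (y p + ∑ t ∈ upTo d n, x p t • w p t) -
      forestTaylor g (w p) (x p) 0 (n + 1) (y p)) =O[⊤] fun p => lam p ^ (n + 1) := by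
  obtain ⟨Cl, hCl⟩ := isBigO_top.1 hlam'
  obtain ⟨Cy, hCy⟩ := isBigO_top.1 hy
  choose Cw hCw using fun t => isBigO_top.1 (hw t)
  choose Cx hCx using fun t => isBigO_top.1 (hx t)
  simp only [norm_one, mul_one] at hCl hCy hCw
  set R := 1 + |Cl| + |Cy| + ∑ t ∈ upTo d n, (|Cw t| + |Cx t|) with hR
  have hsum : 0 ≤ ∑ t ∈ upTo d n, (|Cw t| + |Cx t|) :=
    Finset.sum_nonneg fun t _ => by positivity
  have hsingle : ∀ t ∈ upTo d n, |Cw t| + |Cx t| ≤ R := fun t ht => by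
    have := Finset.single_le_sum (f := fun t => |Cw t| + |Cx t|) (fun t _ => by positivity) ht
    have h1 := abs_nonneg Cl
    have h2 := abs_nonneg Cy
    linarith
  have hR1 : 1 ≤ R := by
    have h1 := abs_nonneg Cl
    have h2 := abs_nonneg Cy
    linarith
  obtain ⟨C, -, hC⟩ := exists_norm_sub_forestTaylor_le hg n R hR1 (n + 1) le_rfl
    (0 : Multiset (DecoratedTree d)) (by simp)
  refine isBigO_top.2 ⟨C, fun p => ?_⟩
  have h := hC (y p) (w p) (x p) (lam p) ?_ ?_ (hlam p) ?_ ?_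
  · rw [dirDeriv_zero] at h
    rwa [Real.norm_of_nonneg (pow_nonneg (hlam p) _)]
  · have h1 := abs_nonneg Cl
    have h2 := le_abs_self Cy
    linarith [hCy p]
  · intro t ht
    have h1 := hsingle t (mem_upTo.2 ht)
    linarith [hCw t p, le_abs_self (Cw t), abs_nonneg (Cx t)]
  · have h1 := abs_nonneg Cy
    linarith [hCl p, le_abs_self (Cl), le_abs_self (lam p), Real.norm_eq_abs (lam p)]
  · intro t ht
    have h1 := hsingle t (mem_upTo.2 ht)
    have h2 := hCx t p
    rw [Real.norm_eq_abs, Real.norm_of_nonneg (pow_nonneg (hlam p) _)] at h2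
    refine h2.trans (mul_le_mul_of_nonneg_right ?_ (pow_nonneg (hlam p) _))
    linarith [le_abs_self (Cx t), abs_nonneg (Cw t)]

end ElementaryDifferentialBounds

-- Composition of B-series with remainder

section Composition

variable {d m : ℕ} {P : Type*}

open DecoratedTree ForestAlgebra Asymptotics

theorem sum_upTo_succ {V : Type*} [AddCommMonoid V] (n : ℕ) (A : DecoratedTree d → V) :
    ∑ t ∈ upTo d (n + 1), A t =
      ∑ b : Fin d, ∑ F ∈ forestsLT d (n + 1), A (DecoratedTree.graft b F) := by
  classical
  rw [← Finset.sum_product']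
  symm
  refine Finset.sum_bij (fun x _ => DecoratedTree.graft x.1 x.2) ?_ ?_ ?_ fun _ _ => rfl
  · intro x hx
    have h := mem_forestsLT.1 (Finset.mem_product.1 hx).2
    have ho : (DecoratedTree.graft x.1 x.2).order = 1 + forestOrder x.2 := order_graft _ _
    rw [mem_upTo]
    omega
  · intro x _ y _ h
    obtain ⟨h1, h2⟩ := DecoratedTree.graft_injective h
    exact Prod.ext h1 h2
  · intro t
    refine DecoratedTree.induction (P := fun t => t ∈ upTo d (n + 1) → ∃ a,
      ∃ (_ : a ∈ Finset.univ ×ˢ forestsLT d (n + 1)), DecoratedTree.graft a.1 a.2 = t)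
      (fun a F _ h => ⟨(a, F), ?_, rfl⟩) t
    have ho : (DecoratedTree.graft a F).order = 1 + forestOrder F := order_graft _ _
    rw [mem_upTo] at h
    rw [Finset.mem_product, mem_forestsLT]
    exact ⟨Finset.mem_univ _, by change forestOrder F < n + 1; omega⟩

theorem isBigO_pow_of_le {lam : P → ℝ} (hlam : lam =O[⊤] fun _ => (1 : ℝ)) {n k : ℕ}
    (h : n ≤ k) : (fun p => lam p ^ k) =O[⊤] fun p => lam p ^ n := by
  obtain ⟨j, rfl⟩ := Nat.exists_eq_add_of_le h
  simp only [pow_add]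
  simpa using (isBigO_refl (fun p => lam p ^ n) ⊤).mul (hlam.pow j)

/-- The remainder of the expansion of the elementary differential of `u` along a B-series. -/
noncomputable def elemDiffRemainder
    (f : Fin d → EuclideanSpace ℝ (Fin m) → EuclideanSpace ℝ (Fin m)) (n : ℕ)
    (φ : ForestAlgebra d →ₐ[ℝ] ℝ) (y y' : EuclideanSpace ℝ (Fin m)) (u : DecoratedTree d) :
    EuclideanSpace ℝ (Fin m) :=
  (u.symmFactor : ℝ)⁻¹ • elemDiff f u y' - ∑ t ∈ upTo d n,
    (forestCoeff {u} (translate φ (MvPolynomial.X t)) / t.symmFactor) • elemDiff f t y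

variable {f : Fin d → EuclideanSpace ℝ (Fin m) → EuclideanSpace ℝ (Fin m)}

-- The affine form of `translate_X_eq` separates the part constant in `x`, which is Davie's error
-- plus the trees with more than `n` vertices, from the part linear in `x`, whose coefficients are
-- the remainders.
open Classical in
theorem perturbed_series_sub_eq (φ : ForestAlgebra d →ₐ[ℝ] ℝ) {n N : ℕ} (hn : n ≤ N)
    (y y' : EuclideanSpace ℝ (Fin m)) (x : DecoratedTree d → ℝ) :
    (y' + ∑ u ∈ upTo d n, (x u / u.symmFactor) • elemDiff f u y') -
      (y + ∑ t ∈ upTo d n, (MvPolynomial.aeval x (translate φ (MvPolynomial.X t)) /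
        t.symmFactor) • elemDiff f t y) =
    (y' - treeSeries f N y φ.toLinearMap) +
      ∑ t ∈ upTo d N \ upTo d n, (φ (MvPolynomial.X t) / t.symmFactor) • elemDiff f t y +
      ∑ u ∈ upTo d n, x u • elemDiffRemainder f n φ y y' u := by
  have hsub : upTo d n ⊆ upTo d N := fun t ht => mem_upTo.2 ((mem_upTo.1 ht).trans hn)
  have h1 : ∑ t ∈ upTo d n, (MvPolynomial.aeval x (translate φ (MvPolynomial.X t)) /
        t.symmFactor) • elemDiff f t y =
      ∑ t ∈ upTo d n, (φ (MvPolynomial.X t) / t.symmFactor) • elemDiff f t y +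
      ∑ u ∈ upTo d n, ∑ t ∈ upTo d n, x u •
        (forestCoeff {u} (translate φ (MvPolynomial.X t)) / t.symmFactor) • elemDiff f t y := by
    rw [Finset.sum_comm, ← Finset.sum_add_distrib]
    refine Finset.sum_congr rfl fun t ht => ?_
    conv_lhs => rw [translate_X_eq φ (mem_upTo.1 ht)]
    simp only [map_add, map_sum, map_smul, MvPolynomial.aeval_X, smul_smul, MvPolynomial.algHom_C,
      Algebra.algebraMap_self, RingHom.id_apply]
    rw [← Finset.sum_smul, ← add_smul, add_div, Finset.sum_div]
    congr 2
    refine Finset.sum_congr rfl fun u _ => ?_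
    rw [smul_eq_mul]
    ring
  have h2 := Finset.sum_sdiff (f := fun t : DecoratedTree d =>
    (φ (MvPolynomial.X t) / t.symmFactor : ℝ) • elemDiff f t y) hsub
  simp only [treeSeries, elemDiffRemainder, smul_sub, Finset.sum_sub_distrib, Finset.smul_sum,
    AlgHom.toLinearMap_apply] at h2 ⊢
  rw [h1, ← h2]
  simp only [div_eq_mul_inv, smul_smul]
  abel

theorem elemDiffRemainder_graft (φ : ForestAlgebra d →ₐ[ℝ] ℝ) (n : ℕ)
    (y y' : EuclideanSpace ℝ (Fin m)) (a : Fin d) (G : Multiset (DecoratedTree d)) :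
    elemDiffRemainder f (n + 1) φ y y' (DecoratedTree.graft a G) =
      ((DecoratedTree.graft a G).symmFactor : ℝ)⁻¹ • elemDiff f (DecoratedTree.graft a G) y' -
      ∑ F ∈ forestsLT d (n + 1), (forestCoeff G (translateForest φ F) /
        (DecoratedTree.graft a F).symmFactor) • elemDiff f (DecoratedTree.graft a F) y := by
  rw [elemDiffRemainder, sum_upTo_succ, Finset.sum_eq_single a]
  · simp only [forestCoeff_translate_graft, if_true]
  · intro b _ hb
    refine Finset.sum_eq_zero fun F _ => ?_
    rw [forestCoeff_translate_graft, if_neg hb, zero_div, zero_smul]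
  · simp

/-- Both Taylor sums are polynomials in `x`: `aeval x ∘ translate φ` is multiplicative, so the
monomial of a forest `F` becomes the evaluation of `translateForest φ F`, and comparing coefficients
of each `G` gives the remainders of `B_+^a(G)`. No forest is lost by truncation, as translation does
not increase the number of vertices. -/
theorem forestTaylor_sub_forestTaylor (hf : ∀ a, ContDiff ℝ ∞ (f a)) (φ : ForestAlgebra d →ₐ[ℝ] ℝ)
    (n : ℕ) (y y' : EuclideanSpace ℝ (Fin m)) (x : DecoratedTree d → ℝ) (a : Fin d) :
    forestTaylor (f a) (fun t => elemDiff f t y') (fun t => x t / t.symmFactor) 0 (n + 1) y' -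
      forestTaylor (f a) (fun t => elemDiff f t y)
        (fun t => MvPolynomial.aeval x (translate φ (MvPolynomial.X t)) / t.symmFactor)
        0 (n + 1) y =
    ∑ G ∈ forestsLT d (n + 1), (G.map x).prod •
      elemDiffRemainder f (n + 1) φ y y' (DecoratedTree.graft a G) := by
  rw [forestTaylor_elemDiff hf, forestTaylor_elemDiff hf a fun t =>
    MvPolynomial.aeval x (translate φ (MvPolynomial.X t))]
  simp only [elemDiffRemainder_graft, smul_sub, Finset.sum_sub_distrib, Finset.smul_sum]
  congr 1
  · simp only [smul_smul, div_eq_mul_inv]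
  · rw [Finset.sum_comm]
    refine Finset.sum_congr rfl fun F hF => ?_
    rw [mem_forestsLT] at hF
    have h1 : (F.map fun t => MvPolynomial.aeval x (translate φ (MvPolynomial.X t))).prod =
        MvPolynomial.aeval x (translateForest φ F) := by
      rw [translateForest, map_multiset_prod, Multiset.map_map]
      rfl
    rw [h1, map_eq_sum_forestCoeff (k := n + 1) (MvPolynomial.aeval x) fun G hG =>
      forestCoeff_translateForest_eq_zero φ (by omega), Finset.sum_div, Finset.sum_smul]
    refine Finset.sum_congr rfl fun G _ => ?_
    simp only [MvPolynomial.aeval_X, smul_smul, smul_eq_mul]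
    congr 1
    ring

/-- If `y'` is given by a B-series at `y` up to `O(lam ^ N)`, then the elementary differentials at
`y'` are given by the composed B-series at `y`. -/
theorem isBigO_elemDiffRemainder (hf : ∀ a, ContDiff ℝ ∞ (f a)) {lam : P → ℝ}
    (hlam : ∀ p, 0 < lam p) (hlam' : lam =O[⊤] fun _ => (1 : ℝ))
    {y y' : P → EuclideanSpace ℝ (Fin m)} (hy : y =O[⊤] fun _ => (1 : ℝ))
    (hy' : y' =O[⊤] fun _ => (1 : ℝ)) {φ : P → ForestAlgebra d →ₐ[ℝ] ℝ}
    (hφ : ∀ t, (fun p => φ p (MvPolynomial.X t)) =O[⊤] fun p => lam p ^ t.order) {N : ℕ}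
    (hyy' : (fun p => y' p - treeSeries f N (y p) (φ p).toLinearMap) =O[⊤] fun p => lam p ^ N) :
    ∀ n ≤ N, ∀ u : DecoratedTree d, u.order ≤ n →
      (fun p => lam p ^ u.order • elemDiffRemainder f n (φ p) (y p) (y' p) u) =O[⊤]
        fun p => lam p ^ (n + 1) := by
  classical
  intro n
  induction n with
  | zero =>
    intro _ u hu
    have := one_le_order u
    omega
  | succ n ih =>
    intro hn u hu
    have ih := ih (by omega)
    revert hu
    refine DecoratedTree.induction (P := fun u => u.order ≤ n + 1 →
      (fun p => lam p ^ u.order • elemDiffRemainder f (n + 1) (φ p) (y p) (y' p) u) =O[⊤]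
        fun p => lam p ^ (n + 1 + 1)) (fun a G _ hG => ?_) u
    have ho : (DecoratedTree.graft a G).order = 1 + forestOrder G := order_graft _ _
    have hone : ∀ k, (fun p => lam p ^ k) =O[⊤] fun _ => (1 : ℝ) := fun k => by
      simpa using isBigO_pow_of_le hlam' (Nat.zero_le k)
    have key : ∀ ξ : DecoratedTree d → ℝ, (fun p => ∑ F ∈ forestsLT d (n + 1), (F.map ξ).prod •
        (lam p ^ forestOrder F •
          elemDiffRemainder f (n + 1) (φ p) (y p) (y' p) (DecoratedTree.graft a F))) =O[⊤]
        fun p => lam p ^ (n + 1) := by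
      intro ξ
      -- The dilation by `lam ^ |t|` gives every perturbation the size of a tree of its order; `c`
      -- holds the values on trees of the convolution of `φ` with the character `x`.
      let x : P → DecoratedTree d → ℝ := fun p t => lam p ^ t.order * ξ t
      let c : P → DecoratedTree d → ℝ := fun p t =>
        MvPolynomial.aeval (x p) (translate (φ p) (MvPolynomial.X t))
      have hx : ∀ t, (fun p => x p t / t.symmFactor) =O[⊤] fun p => lam p ^ t.order := by
        intro t
        refine ((isBigO_refl (fun p => lam p ^ t.order) ⊤).const_mul_left
          (ξ t / t.symmFactor)).congr_left fun p => ?_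
        simp only [x]
        ring
      have hc : ∀ t, (fun p => c p t / t.symmFactor) =O[⊤] fun p => lam p ^ t.order := by
        intro t
        simp only [div_eq_inv_mul]
        exact (isWeightedBigO_eval (isWeightedBigO_translate hφ t) ξ).const_mul_left _
      have hbdd : ∀ {z : P → EuclideanSpace ℝ (Fin m)} {b : P → DecoratedTree d → ℝ},
          z =O[⊤] (fun _ => (1 : ℝ)) →
          (∀ t, (fun p => b p t) =O[⊤] fun p => lam p ^ t.order) →
          (fun p => z p + ∑ t ∈ upTo d n, b p t • elemDiff f t (z p)) =O[⊤]
            fun _ => (1 : ℝ) := by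
        intro z b hz hb
        refine hz.add (IsBigO.fun_sum fun t _ => ?_)
        simpa using ((hb t).trans (hone _)).smul (isBigO_elemDiff hf hz t)
      have h1 : (fun p => (y' p + ∑ t ∈ upTo d n, (x p t / t.symmFactor) • elemDiff f t (y' p)) -
          (y p + ∑ t ∈ upTo d n, (c p t / t.symmFactor) • elemDiff f t (y p))) =O[⊤]
          fun p => lam p ^ (n + 1) := by
        -- The three contributions: Davie's error, of order `N ≥ n + 1`; trees with at least `n + 1`
        -- vertices; and the remainders at level `n`, controlled by induction.
        simp only [c, perturbed_series_sub_eq (f := f) (φ _) (show n ≤ N by omega)]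
        refine ((hyy'.trans (isBigO_pow_of_le hlam' hn)).add
          (IsBigO.fun_sum fun t ht => ?_)).add (IsBigO.fun_sum fun t ht => ?_)
        · have ht' : n + 1 ≤ t.order := by
            have := (Finset.mem_sdiff.1 ht).2
            rw [mem_upTo] at this
            omega
          simp only [div_eq_inv_mul]
          simpa using (((hφ t).trans (isBigO_pow_of_le hlam' ht')).const_mul_left
            (t.symmFactor : ℝ)⁻¹).smul (isBigO_elemDiff hf hy t)
        · simp only [x, mul_comm (lam _ ^ t.order), mul_smul]
          exact (ih t (mem_upTo.1 ht)).const_smul_left (ξ t)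
      have h2 := (isBigO_comp_sub_comp (hf a) (hbdd hy' hx) (hbdd hy hc)).trans h1
      have h3 := isBigO_sub_forestTaylor (hf a) (n := n) (fun p => (hlam p).le) hlam' hy'
        (isBigO_elemDiff hf hy') hx
      have h4 := isBigO_sub_forestTaylor (hf a) (n := n) (fun p => (hlam p).le) hlam' hy
        (isBigO_elemDiff hf hy) hc
      -- Difference of the Taylor polynomials: difference of the values of `f_a`, minus the Taylor
      -- error at `y'`, plus that at `y`.
      refine ((h2.sub h3).add h4).congr_left fun p => ?_
      have h5 := forestTaylor_sub_forestTaylor hf (φ p) n (y p) (y' p) (x p) a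
      simp only [smul_smul, mul_comm _ (lam p ^ _)]
      simp only [x, map_prod_scale] at h5
      rw [← h5]
      abel
    have h6 := isBigO_coeff_of_forall_eval (forestsLT d (n + 1)) (fun F p => lam p ^ forestOrder F •
      elemDiffRemainder f (n + 1) (φ p) (y p) (y' p) (DecoratedTree.graft a F)) key
      (mem_forestsLT.2 (show forestOrder G < n + 1 by omega))
    -- The root is the extra vertex of `B_+^a(G)`; multiplication by `lam` raises the order from `n
    -- + 1` to `n + 2`.
    refine (((isBigO_refl lam ⊤).smul h6).congr_left fun p => ?_).congr_right fun p => ?_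
    · rw [smul_smul, ho, pow_add, pow_one]
    · rw [smul_eq_mul, pow_succ' _ (n + 1)]

/-- The remainder for a tree with `k` vertices is `O(lam ^ (N + 1 - k))`. -/
theorem isBigO_elemDiffRemainder_pow_sub (hf : ∀ a, ContDiff ℝ ∞ (f a)) {lam : P → ℝ}
    (hlam : ∀ p, 0 < lam p) (hlam' : lam =O[⊤] fun _ => (1 : ℝ))
    {y y' : P → EuclideanSpace ℝ (Fin m)} (hy : y =O[⊤] fun _ => (1 : ℝ))
    (hy' : y' =O[⊤] fun _ => (1 : ℝ)) {φ : P → ForestAlgebra d →ₐ[ℝ] ℝ}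
    (hφ : ∀ t, (fun p => φ p (MvPolynomial.X t)) =O[⊤] fun p => lam p ^ t.order) {N : ℕ}
    (hyy' : (fun p => y' p - treeSeries f (N + 1) (y p) (φ p).toLinearMap) =O[⊤]
      fun p => lam p ^ (N + 1)) {u : DecoratedTree d} (hu : u.order ≤ N) :
    (fun p => elemDiffRemainder f N (φ p) (y p) (y' p) u) =O[⊤]
      fun p => lam p ^ (N + 1 - u.order) := by
  have h := isBigO_elemDiffRemainder hf hlam hlam' hy hy' hφ hyy' N (Nat.le_succ N) u hu
  refine (((isBigO_refl (fun p => (lam p ^ u.order)⁻¹) ⊤).smul h).congr_left fun p => ?_).congr_right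
    fun p => ?_
  · rw [smul_smul, inv_mul_cancel₀ (pow_ne_zero _ (hlam p).ne'), one_smul]
  · have h1 : N + 1 = u.order + (N + 1 - u.order) := by omega
    conv_lhs => rw [h1]
    rw [smul_eq_mul, pow_add, ← mul_assoc, inv_mul_cancel₀ (pow_ne_zero _ (hlam p).ne'), one_mul]

end Composition

-- Translation by a character in the Hopf algebra

section HopfTranslation

variable {d m : ℕ} {H : Type*} [CommRing H] [HopfAlgebra ℝ H]

open DecoratedTree ForestAlgebra

theorem counit_dualMul (ψ : Module.Dual ℝ H) : dualMul (Coalgebra.counit (R := ℝ)) ψ = ψ :=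
  congrArg WithConv.ofConv (one_mul (WithConv.toConv (ψ : H →ₗ[ℝ] ℝ)))

theorem dualMul_counit (ψ : Module.Dual ℝ H) : dualMul ψ (Coalgebra.counit (R := ℝ)) = ψ :=
  congrArg WithConv.ofConv (mul_one (WithConv.toConv (ψ : H →ₗ[ℝ] ℝ)))

/-- Characters of a commutative Hopf algebra form a group under convolution, and an idempotent of a
group is its unit. -/
theorem eq_counit_of_dualMul_self {φ : H →ₐ[ℝ] ℝ}
    (h : φ.toLinearMap = dualMul φ.toLinearMap φ.toLinearMap) (x : H) :
    φ x = Coalgebra.counit (R := ℝ) x := by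
  have h1 : WithConv.toConv φ * WithConv.toConv φ = WithConv.toConv φ := by
    refine WithConv.ext (AlgHom.toLinearMap_injective ?_)
    exact h.symm
  have h2 := mul_eq_left.1 h1
  exact congrArg (fun ψ : WithConv (H →ₐ[ℝ] ℝ) => ψ x) h2

/-- The algebra morphism `(φ ⊗ id) ∘ Δ` of a Hopf algebra. -/
noncomputable def hopfTranslate (φ : H →ₐ[ℝ] ℝ) : H →ₐ[ℝ] H :=
  (Algebra.TensorProduct.lid ℝ H).toAlgHom.comp
    ((Algebra.TensorProduct.map φ (AlgHom.id ℝ H)).comp (Bialgebra.comulAlgHom ℝ H))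

theorem hopfTranslate_apply (φ : H →ₐ[ℝ] ℝ) (x : H) :
    hopfTranslate φ x = TensorProduct.lid ℝ H
      (TensorProduct.map φ.toLinearMap LinearMap.id (Coalgebra.comul x)) := rfl

theorem dualMul_apply_eq (φ : H →ₐ[ℝ] ℝ) (ψ : Module.Dual ℝ H) (x : H) :
    dualMul φ.toLinearMap ψ x = ψ (hopfTranslate φ x) := by
  rw [hopfTranslate_apply, dualMul, LinearMap.comp_apply, LinearMap.comp_apply]
  generalize (Coalgebra.comul x : H ⊗[ℝ] H) = z
  induction z with
  | zero => simp
  | tmul a b => simp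
  | add a b ha hb => simp only [map_add, ha, hb]

/-- The same recursion as `translate_X_graft`, now obtained from the cocycle property of `L a`. -/
theorem hopfTranslate_cocycle {𝒜 : ℕ → Submodule ℝ H} {B : LinearMap.BilinForm ℝ H}
    {L : Fin d → H →ₗ[ℝ] H} (hL : IsCocycleFamily 𝒜 B L) (φ : H →ₐ[ℝ] ℝ) (a : Fin d) (x : H) :
    hopfTranslate φ (L a x) = L a (hopfTranslate φ x) + algebraMap ℝ H (φ (L a x)) := by
  rw [hopfTranslate_apply, hL.cocycle, map_add, map_add, hopfTranslate_apply]
  congr 1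
  · generalize (Coalgebra.comul x : H ⊗[ℝ] H) = z
    induction z with
    | zero => simp
    | tmul a b => simp
    | add a b ha hb => simp only [map_add, ha, hb]
  · simp [Algebra.algebraMap_eq_smul_one]

/-- Both sides are algebra morphisms, so trees suffice; there `B_+^a` and `L a` obey the same
recursion under translation. It also shows that the image of `Λ` is stable under `(φ ⊗ id) ∘ Δ`. -/
theorem universalMap_translate {𝒜 : ℕ → Submodule ℝ H} {B : LinearMap.BilinForm ℝ H}
    {L : Fin d → H →ₗ[ℝ] H} (hL : IsCocycleFamily 𝒜 B L) (φ : H →ₐ[ℝ] ℝ) (q : ForestAlgebra d) :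
    universalMap L (translate (φ.comp (universalMap L)) q) =
      hopfTranslate φ (universalMap L q) := by
  suffices h : (universalMap L).comp (translate (φ.comp (universalMap L))) =
      (hopfTranslate φ).comp (universalMap L) from DFunLike.congr_fun h q
  refine MvPolynomial.algHom_ext fun t => ?_
  refine DecoratedTree.induction (P := fun t =>
    ((universalMap L).comp (translate (φ.comp (universalMap L)))) (MvPolynomial.X t) =
      ((hopfTranslate φ).comp (universalMap L)) (MvPolynomial.X t)) (fun a F ih => ?_) t
  simp only [AlgHom.comp_apply] at ih ⊢
  have h1 : universalMap L (translateForest (φ.comp (universalMap L)) F) =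
      hopfTranslate φ (universalMap L (F.map MvPolynomial.X).prod) := by
    rw [translateForest, map_multiset_prod, map_multiset_prod, map_multiset_prod,
      Multiset.map_map, Multiset.map_map, Multiset.map_map]
    exact congrArg Multiset.prod (Multiset.map_congr rfl ih)
  have h2 : universalMap L (MvPolynomial.X (DecoratedTree.graft a F)) =
      L a (universalMap L (F.map MvPolynomial.X).prod) := by
    rw [← universalMap_graft, graft_prod_X]
  rw [translate_X_graft, map_add, universalMap_graft, h1, MvPolynomial.algHom_C,
    AlgHom.comp_apply, h2, hopfTranslate_cocycle hL]

end HopfTranslation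

-- Passing from trees to the orthogonal basis

section OrthogonalBasis

variable {d m : ℕ} {H : Type*} [CommRing H] [HopfAlgebra ℝ H] {𝒜 : ℕ → Submodule ℝ H}
  {B : LinearMap.BilinForm ℝ H} {L : Fin d → H →ₗ[ℝ] H} {S : Set H}

open DecoratedTree ForestAlgebra

theorem IsOrthogonalHomogeneousBasis.one_ne_zero {I : Submodule ℝ H}
    (hS : IsOrthogonalHomogeneousBasis 𝒜 B I S) : (1 : H) ≠ 0 := by
  intro h
  refine hS.self_ne_zero 1 hS.one_mem ?_
  rw [h]
  simp

theorem IsOrthogonalHomogeneousBasis.one_mem_degreeLT {I : Submodule ℝ H}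
    (h𝒜 : IsConnectedGrading 𝒜) (hS : IsOrthogonalHomogeneousBasis 𝒜 B I S) {N : ℕ}
    (hN : 0 < N) : (1 : H) ∈ degreeLT 𝒜 S N :=
  ⟨hS.one_mem, 0, hN, by rw [h𝒜.zero_eq]; exact Submodule.mem_span_singleton_self _⟩

/-- The counit kills positive degrees. A basis element of degree zero is a multiple of `1`, and
orthogonality to `1` would contradict non-isotropy unless it is `1` itself. -/
theorem IsOrthogonalHomogeneousBasis.counit_eq_zero {I : Submodule ℝ H}
    (h𝒜 : IsConnectedGrading 𝒜) (hS : IsOrthogonalHomogeneousBasis 𝒜 B I S) {h : H} (hh : h ∈ S)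
    (h1 : h ≠ 1) : Coalgebra.counit (R := ℝ) h = 0 := by
  obtain ⟨n, hn⟩ := hS.homogeneous h hh
  refine h𝒜.counit_eq_zero n ?_ h hn
  rintro rfl
  rw [h𝒜.zero_eq] at hn
  obtain ⟨c, rfl⟩ := Submodule.mem_span_singleton.1 hn
  have h2 := hS.orthogonal _ hh 1 hS.one_mem h1
  have h3 := hS.self_ne_zero _ hh
  rw [map_smul, LinearMap.smul_apply, smul_eq_mul] at h2
  rcases mul_eq_zero.1 h2 with h4 | h4
  · exact h3 (by simp [h4])
  · exact hS.self_ne_zero 1 hS.one_mem h4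

theorem normalizedDual_self {I : Submodule ℝ H} (hS : IsOrthogonalHomogeneousBasis 𝒜 B I S)
    {h : H} (hh : h ∈ S) : normalizedDual B h h = 1 := by
  simp [normalizedDual, inv_mul_cancel₀ (hS.self_ne_zero h hh)]

theorem normalizedDual_of_ne {I : Submodule ℝ H} (hS : IsOrthogonalHomogeneousBasis 𝒜 B I S)
    {h g : H} (hh : h ∈ S) (hg : g ∈ S) (hne : h ≠ g) : normalizedDual B h g = 0 := by
  simp [normalizedDual, hS.orthogonal h hh g hg hne]

/-- A homogeneous element of the span involves only basis elements of its own degree, so the sum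
truncated at degree `N > n` already recovers it. -/
theorem IsOrthogonalHomogeneousBasis.sum_normalizedDual
    (h𝒜 : IsConnectedGrading 𝒜) (hL : IsCocycleFamily 𝒜 B L)
    (hS : IsOrthogonalHomogeneousBasis 𝒜 B (LinearMap.range (universalMap L).toLinearMap) S)
    {n N : ℕ} (hn : n < N) {z : H} (hz : z ∈ LinearMap.range (universalMap L).toLinearMap)
    (hzn : z ∈ 𝒜 n) :
    ∑ g ∈ (hS.finite_degreeLT h𝒜 hL N).toFinset, normalizedDual B g z • g = z := by
  rw [← hS.span_eq] at hz
  have h1 := h𝒜.mem_span_inter hS.homogeneous hz hzn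
  induction h1 using Submodule.span_induction with
  | mem q hq =>
    have hqm : q ∈ (hS.finite_degreeLT h𝒜 hL N).toFinset := by
      rw [Set.Finite.mem_toFinset]
      exact ⟨hq.1, n, hn, hq.2⟩
    rw [Finset.sum_eq_single_of_mem q hqm, normalizedDual_self hS hq.1, one_smul]
    intro g hg hne
    rw [Set.Finite.mem_toFinset] at hg
    rw [normalizedDual_of_ne hS hg.1 hq.1 hne, zero_smul]
  | zero => simp
  | add x y hx hy ihx ihy =>
    have hsub : {q | q ∈ S ∧ q ∈ 𝒜 n} ⊆ (𝒜 n : Set H) := fun q hq => hq.2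
    have hsub' : {q | q ∈ S ∧ q ∈ 𝒜 n} ⊆ S := fun q hq => hq.1
    simp only [map_add, add_smul, Finset.sum_add_distrib]
    rw [ihx (Submodule.span_mono hsub' hx) (Submodule.span_le.2 hsub hx),
      ihy (Submodule.span_mono hsub' hy) (Submodule.span_le.2 hsub hy)]
  | smul c x hx ihx =>
    have hsub : {q | q ∈ S ∧ q ∈ 𝒜 n} ⊆ (𝒜 n : Set H) := fun q hq => hq.2
    have hsub' : {q | q ∈ S ∧ q ∈ 𝒜 n} ⊆ S := fun q hq => hq.1
    simp only [map_smul, smul_assoc]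
    rw [← Finset.smul_sum, ihx (Submodule.span_mono hsub' hx) (Submodule.span_le.2 hsub hx)]

theorem elemDiffBar_eq_sum
    (h𝒜 : IsConnectedGrading 𝒜) (hL : IsCocycleFamily 𝒜 B L)
    (hS : IsOrthogonalHomogeneousBasis 𝒜 B (LinearMap.range (universalMap L).toLinearMap) S)
    (f : Fin d → EuclideanSpace ℝ (Fin m) → EuclideanSpace ℝ (Fin m)) {N : ℕ} {h : H}
    (hh : h ∈ degreeLT 𝒜 S (N + 1)) (y : EuclideanSpace ℝ (Fin m)) :
    elemDiffBar B L f h y = ∑ t ∈ upTo d N,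
      (B h (universalMap L (MvPolynomial.X t)) / t.symmFactor) • elemDiff f t y := by
  rw [elemDiffBar, elemDiffDual]
  refine finsum_eq_sum_of_support_subset _ fun t ht => ?_
  obtain ⟨hhS, n, hn, hhn⟩ := hh
  rw [Finset.mem_coe, mem_upTo]
  by_contra hlt
  refine ht ?_
  have h0 := hS.pairing_tree_eq_zero h𝒜 hL hhS hhn t (by omega)
  change (B h (universalMap L (MvPolynomial.X t)) / (t.symmFactor : ℝ)) • elemDiff f t y = 0
  rw [h0, zero_div, zero_smul]

/-- The unit has degree zero and no tree is empty. Hence the basis element `1` may be added to, or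
dropped from, sums of elementary differentials. -/
theorem elemDiffBar_one
    (h𝒜 : IsConnectedGrading 𝒜) (hL : IsCocycleFamily 𝒜 B L)
    (hS : IsOrthogonalHomogeneousBasis 𝒜 B (LinearMap.range (universalMap L).toLinearMap) S)
    (f : Fin d → EuclideanSpace ℝ (Fin m) → EuclideanSpace ℝ (Fin m))
    (y : EuclideanSpace ℝ (Fin m)) : elemDiffBar B L f 1 y = 0 := by
  rw [elemDiffBar_eq_sum h𝒜 hL hS f (hS.one_mem_degreeLT h𝒜 (Nat.succ_pos 0))]
  refine Finset.sum_eq_zero fun t ht => ?_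
  have := one_le_order t
  have := mem_upTo.1 ht
  omega

/-- A sum over trees of a linear form on the Hopf algebra, as a sum over the orthogonal basis. -/
theorem sum_upTo_eq_sum_degreeLT
    (h𝒜 : IsConnectedGrading 𝒜) (hL : IsCocycleFamily 𝒜 B L)
    (hS : IsOrthogonalHomogeneousBasis 𝒜 B (LinearMap.range (universalMap L).toLinearMap) S)
    (f : Fin d → EuclideanSpace ℝ (Fin m) → EuclideanSpace ℝ (Fin m)) (N : ℕ)
    (ψ : Module.Dual ℝ H) (y : EuclideanSpace ℝ (Fin m)) :
    ∑ t ∈ upTo d N, (ψ (universalMap L (MvPolynomial.X t)) / t.symmFactor) • elemDiff f t y =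
      ∑ g ∈ (hS.finite_degreeLT h𝒜 hL (N + 1)).toFinset,
        ψ g • (B g g)⁻¹ • elemDiffBar B L f g y := by
  have h1 : ∀ g ∈ (hS.finite_degreeLT h𝒜 hL (N + 1)).toFinset,
      ψ g • (B g g)⁻¹ • elemDiffBar B L f g y = ∑ t ∈ upTo d N,
        (normalizedDual B g (universalMap L (MvPolynomial.X t)) * ψ g / t.symmFactor) •
          elemDiff f t y := by
    intro g hg
    rw [Set.Finite.mem_toFinset] at hg
    rw [elemDiffBar_eq_sum h𝒜 hL hS f hg, Finset.smul_sum, Finset.smul_sum]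
    refine Finset.sum_congr rfl fun t _ => ?_
    rw [smul_smul, smul_smul]
    congr 1
    simp only [normalizedDual, LinearMap.smul_apply, smul_eq_mul]
    ring
  rw [Finset.sum_congr rfl h1, Finset.sum_comm]
  refine Finset.sum_congr rfl fun t ht => ?_
  have h2 := hS.sum_normalizedDual h𝒜 hL (Nat.lt_succ_of_le (mem_upTo.1 ht))
    (LinearMap.mem_range_self _ (MvPolynomial.X t)) (hL.universalMap_X_mem h𝒜 t)
  rw [AlgHom.toLinearMap_apply] at h2
  rw [← Finset.sum_smul, ← Finset.sum_div]
  congr 2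
  conv_lhs => rw [← h2]
  rw [map_sum]
  refine Finset.sum_congr rfl fun g _ => ?_
  rw [map_smul, smul_eq_mul]

/-- The two forms agree on the orthogonal basis; beyond the image of `Λ` the pairing with `1` is not
controlled. -/
theorem normalizedDual_one_eq_counit
    (h𝒜 : IsConnectedGrading 𝒜)
    (hS : IsOrthogonalHomogeneousBasis 𝒜 B (LinearMap.range (universalMap L).toLinearMap) S)
    {z : H} (hz : z ∈ LinearMap.range (universalMap L).toLinearMap) :
    normalizedDual B 1 z = Coalgebra.counit (R := ℝ) z := by
  rw [← hS.span_eq] at hz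
  induction hz using Submodule.span_induction with
  | mem g hg =>
    rcases eq_or_ne g 1 with rfl | hne
    · rw [normalizedDual_self hS hS.one_mem, Bialgebra.counit_one]
    · rw [normalizedDual_of_ne hS hS.one_mem hg hne.symm, hS.counit_eq_zero h𝒜 hg hne]
  | zero => simp
  | add x y _ _ ihx ihy => rw [map_add, map_add, ihx, ihy]
  | smul c x _ ihx => rw [map_smul, map_smul, ihx]

/-- The translate of `g` stays in the image of `Λ`, where the normalized form of `1` is the counit,
the unit of convolution. Thus the remainder condition at `h = 1` reduces to the expansion of `Y`
itself. -/
theorem dualMul_normalizedDual_one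
    (h𝒜 : IsConnectedGrading 𝒜) (hL : IsCocycleFamily 𝒜 B L)
    (hS : IsOrthogonalHomogeneousBasis 𝒜 B (LinearMap.range (universalMap L).toLinearMap) S)
    (φ : H →ₐ[ℝ] ℝ) {g : H} (hg : g ∈ S) :
    dualMul φ.toLinearMap (normalizedDual B 1) g = φ g := by
  have hg' : g ∈ LinearMap.range (universalMap L).toLinearMap := by
    rw [← hS.span_eq]; exact Submodule.subset_span hg
  obtain ⟨q, hq⟩ := hg'
  have hr : hopfTranslate φ g ∈ LinearMap.range (universalMap L).toLinearMap :=
    ⟨translate (φ.comp (universalMap L)) q, by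
      rw [← hq]; exact universalMap_translate hL φ q⟩
  rw [dualMul_apply_eq, normalizedDual_one_eq_counit h𝒜 hS hr, ← dualMul_apply_eq,
    dualMul_counit]
  rfl

/-- The expansion of the path of elementary differentials in the orthogonal basis has the
remainders of the expansions over trees. -/
theorem elemDiffBar_sub_sum_eq
    (h𝒜 : IsConnectedGrading 𝒜) (hL : IsCocycleFamily 𝒜 B L)
    (hS : IsOrthogonalHomogeneousBasis 𝒜 B (LinearMap.range (universalMap L).toLinearMap) S)
    (f : Fin d → EuclideanSpace ℝ (Fin m) → EuclideanSpace ℝ (Fin m)) {N : ℕ} {h : H}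
    (hh : h ∈ degreeLT 𝒜 S (N + 1)) (h1 : h ≠ 1) (φ : H →ₐ[ℝ] ℝ)
    (y y' : EuclideanSpace ℝ (Fin m)) :
    (B h h)⁻¹ • elemDiffBar B L f h y' - ∑ g ∈ (hS.finite_degreeLT h𝒜 hL (N + 1)).toFinset,
      dualMul φ.toLinearMap (normalizedDual B h) g • (B g g)⁻¹ • elemDiffBar B L f g y =
    ∑ u ∈ upTo d N, normalizedDual B h (universalMap L (MvPolynomial.X u)) •
      elemDiffRemainder f N (φ.comp (universalMap L)) y y' u := by
  -- This removes the constant term of the affine polynomial `translate φ τ`; only its tree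
  -- coefficients, which define the remainders, are left.
  have hone : normalizedDual B h 1 = 0 := normalizedDual_of_ne hS hh.1 hS.one_mem h1
  rw [← sum_upTo_eq_sum_degreeLT h𝒜 hL hS f N (dualMul φ.toLinearMap (normalizedDual B h)),
    elemDiffBar_eq_sum h𝒜 hL hS f hh]
  simp only [elemDiffRemainder, smul_sub, Finset.sum_sub_distrib, Finset.smul_sum]
  congr 1
  · refine Finset.sum_congr rfl fun t _ => ?_
    simp only [smul_smul, normalizedDual, LinearMap.smul_apply, smul_eq_mul]
    congr 1
    ring
  · rw [Finset.sum_comm]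
    refine Finset.sum_congr rfl fun t ht => ?_
    have h2 : dualMul φ.toLinearMap (normalizedDual B h) (universalMap L (MvPolynomial.X t)) =
        ∑ u ∈ upTo d N, forestCoeff {u}
          (translate (φ.comp (universalMap L)) (MvPolynomial.X t)) *
            normalizedDual B h (universalMap L (MvPolynomial.X u)) := by
      rw [dualMul_apply_eq, ← universalMap_translate hL, translate_X_eq _ (mem_upTo.1 ht)]
      rw [map_add, map_add, MvPolynomial.algHom_C, Algebra.algebraMap_eq_smul_one, map_smul, hone,
        smul_zero, zero_add, map_sum, map_sum, ← translate_X_eq _ (mem_upTo.1 ht)]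
      refine Finset.sum_congr rfl fun u _ => ?_
      rw [map_smul, map_smul, smul_eq_mul]
    rw [h2, Finset.sum_div, Finset.sum_smul]
    refine Finset.sum_congr rfl fun u _ => ?_
    rw [smul_smul]
    congr 1
    ring

variable (f : Fin d → EuclideanSpace ℝ (Fin m) → EuclideanSpace ℝ (Fin m))

theorem normalizedDual_elemDiffPath
    (h𝒜 : IsConnectedGrading 𝒜) (hL : IsCocycleFamily 𝒜 B L)
    (hS : IsOrthogonalHomogeneousBasis 𝒜 B (LinearMap.range (universalMap L).toLinearMap) S)
    (M : ℕ) (Y : ℝ → EuclideanSpace ℝ (Fin m)) (t : ℝ) (i : Fin m) (ψ : Module.Dual ℝ H) :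
    ψ (elemDiffPath 𝒜 B L S f M Y t i) = Y t i * ψ 1 +
      ∑ g ∈ (hS.finite_degreeLT h𝒜 hL M).toFinset,
        elemDiffBar B L f g (Y t) i / B g g * ψ g := by
  classical
  have hfin : (degreeLT 𝒜 S M \ {1}).Finite := (hS.finite_degreeLT h𝒜 hL M).sdiff
  rw [elemDiffPath, map_add, map_smul, smul_eq_mul, finsum_mem_eq_finite_toFinset_sum _ hfin,
    map_sum]
  congr 1
  refine (Finset.sum_subset (fun g hg => ?_) fun g hg hg' => ?_).trans
    (Finset.sum_congr rfl fun g _ => ?_)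
  · rw [Set.Finite.mem_toFinset] at hg ⊢
    exact hg.1
  · rw [Set.Finite.mem_toFinset] at hg hg'
    have h1 : g = 1 := by
      by_contra hne
      exact hg' ⟨hg, hne⟩
    rw [h1, elemDiffBar_one h𝒜 hL hS]
    simp
  · rw [map_smul, smul_eq_mul]

theorem coeffAt_one_elemDiffPath
    (h𝒜 : IsConnectedGrading 𝒜) (hL : IsCocycleFamily 𝒜 B L)
    (hS : IsOrthogonalHomogeneousBasis 𝒜 B (LinearMap.range (universalMap L).toLinearMap) S)
    (M : ℕ) (Y : ℝ → EuclideanSpace ℝ (Fin m)) (t : ℝ) :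
    coeffAt B 1 (elemDiffPath 𝒜 B L S f M Y t) = Y t := by
  ext i
  change normalizedDual B 1 (elemDiffPath 𝒜 B L S f M Y t i) = Y t i
  rw [normalizedDual_elemDiffPath f h𝒜 hL hS, normalizedDual_self hS hS.one_mem, mul_one,
    Finset.sum_eq_zero, add_zero]
  intro g hg
  rw [Set.Finite.mem_toFinset] at hg
  rcases eq_or_ne g 1 with rfl | hne
  · rw [elemDiffBar_one h𝒜 hL hS]; simp
  · rw [normalizedDual_of_ne hS hS.one_mem hg.1 hne.symm, mul_zero]

theorem coeffAt_elemDiffPath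
    (h𝒜 : IsConnectedGrading 𝒜) (hL : IsCocycleFamily 𝒜 B L)
    (hS : IsOrthogonalHomogeneousBasis 𝒜 B (LinearMap.range (universalMap L).toLinearMap) S)
    (M : ℕ) (Y : ℝ → EuclideanSpace ℝ (Fin m)) (t : ℝ) {h : H} (hh : h ∈ degreeLT 𝒜 S M)
    (h1 : h ≠ 1) :
    coeffAt B h (elemDiffPath 𝒜 B L S f M Y t) = (B h h)⁻¹ • elemDiffBar B L f h (Y t) := by
  ext i
  change normalizedDual B h (elemDiffPath 𝒜 B L S f M Y t i) =
    (B h h)⁻¹ * elemDiffBar B L f h (Y t) i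
  have hm : h ∈ (hS.finite_degreeLT h𝒜 hL M).toFinset := by
    rw [Set.Finite.mem_toFinset]; exact hh
  rw [normalizedDual_elemDiffPath f h𝒜 hL hS, normalizedDual_of_ne hS hh.1 hS.one_mem h1,
    mul_zero, zero_add, Finset.sum_eq_single_of_mem h hm, normalizedDual_self hS hh.1]
  · ring
  · intro g hg hne
    rw [Set.Finite.mem_toFinset] at hg
    rw [normalizedDual_of_ne hS hh.1 hg.1 hne.symm, mul_zero]

theorem elemDiffPath_mem_span
    (h𝒜 : IsConnectedGrading 𝒜) (hL : IsCocycleFamily 𝒜 B L)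
    (hS : IsOrthogonalHomogeneousBasis 𝒜 B (LinearMap.range (universalMap L).toLinearMap) S)
    (M : ℕ) (Y : ℝ → EuclideanSpace ℝ (Fin m)) (t : ℝ) (i : Fin m) :
    elemDiffPath 𝒜 B L S f M Y t i ∈ Submodule.span ℝ S := by
  have hfin : (degreeLT 𝒜 S M \ {1}).Finite := (hS.finite_degreeLT h𝒜 hL M).sdiff
  rw [elemDiffPath, finsum_mem_eq_finite_toFinset_sum _ hfin]
  refine Submodule.add_mem _ (Submodule.smul_mem _ _ (Submodule.subset_span hS.one_mem))
    (Submodule.sum_mem _ fun g hg => Submodule.smul_mem _ _ (Submodule.subset_span ?_))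
  rw [Set.Finite.mem_toFinset] at hg
  exact hg.1.1

end OrthogonalBasis

-- Davie solutions and the controlled rough path estimates

section Davie

variable {d m : ℕ} {H : Type*} [CommRing H] [HopfAlgebra ℝ H] {𝒜 : ℕ → Submodule ℝ H}
  {B : LinearMap.BilinForm ℝ H} {L : Fin d → H →ₗ[ℝ] H} {S : Set H}
  {f : Fin d → EuclideanSpace ℝ (Fin m) → EuclideanSpace ℝ (Fin m)} {γ T : ℝ}
  {X : ℝ → ℝ → H →ₐ[ℝ] ℝ} {Y : ℝ → EuclideanSpace ℝ (Fin m)}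

open DecoratedTree ForestAlgebra Asymptotics

/-- The pairs `s < t` in `[0, T]`. -/
abbrev TimePair (T : ℝ) : Type := {p : ℝ × ℝ // 0 ≤ p.1 ∧ p.1 < p.2 ∧ p.2 ≤ T}

/-- The natural scale `(t - s) ^ γ` of a path of regularity `γ`. -/
noncomputable def timeScale (γ : ℝ) (p : TimePair T) : ℝ := (p.1.2 - p.1.1) ^ γ

theorem timeScale_pos (γ : ℝ) (p : TimePair T) : 0 < timeScale γ p :=
  Real.rpow_pos_of_pos (sub_pos.2 p.2.2.1) _

theorem timeScale_pow (γ : ℝ) (p : TimePair T) (n : ℕ) :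
    timeScale γ p ^ n = (p.1.2 - p.1.1) ^ (γ * n) := by
  rw [timeScale, Real.rpow_mul_natCast (sub_pos.2 p.2.2.1).le]

theorem isBigO_timeScale (hγ : 0 < γ) :
    (timeScale γ : TimePair T → ℝ) =O[⊤] fun _ => (1 : ℝ) := by
  refine isBigO_top.2 ⟨T ^ γ, fun p => ?_⟩
  rw [Real.norm_of_nonneg (timeScale_pos γ p).le, norm_one, mul_one]
  exact Real.rpow_le_rpow (sub_pos.2 p.2.2.1).le (by linarith [p.2.1, p.2.2.2]) hγ.le

theorem IsRoughPath.isBigO_tree (h𝒜 : IsConnectedGrading 𝒜) (hL : IsCocycleFamily 𝒜 B L)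
    (hX : IsRoughPath 𝒜 γ T X) (t : DecoratedTree d) :
    (fun p : TimePair T => (X p.1.1 p.1.2).comp (universalMap L) (MvPolynomial.X t)) =O[⊤]
      fun p => timeScale γ p ^ t.order := by
  obtain ⟨C, hC⟩ := hX.holder _ _ (hL.universalMap_X_mem h𝒜 t)
  refine isBigO_top.2 ⟨C, fun p => ?_⟩
  obtain ⟨⟨s, t'⟩, h0, h1, h2⟩ := p
  dsimp only at h0 h1 h2
  rw [Real.norm_of_nonneg (pow_nonneg (timeScale_pos γ _).le _), timeScale_pow, Real.norm_eq_abs]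
  have := hC s ⟨h0, by linarith⟩ t' ⟨by linarith, h2⟩ h1.ne
  rwa [abs_of_pos (sub_pos.2 h1)] at this

theorem norm_treeSeries_le (N : ℕ) (y : EuclideanSpace ℝ (Fin m))
    (φ : Module.Dual ℝ (ForestAlgebra d)) {K : DecoratedTree d → ℝ}
    (hK : ∀ t, |φ (MvPolynomial.X t)| ≤ K t) :
    ‖treeSeries f N y φ‖ ≤ ‖y‖ + ∑ t ∈ upTo d N, K t / t.symmFactor * ‖elemDiff f t y‖ := by
  refine (norm_add_le _ _).trans (add_le_add_right ((norm_sum_le _ _).trans ?_) _)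
  refine Finset.sum_le_sum fun t _ => ?_
  rw [norm_smul, norm_div, Real.norm_natCast, Real.norm_eq_abs]
  have := symmFactor_pos t
  have := hK t
  gcongr

theorem IsRoughPath.exists_abs_tree_le (h𝒜 : IsConnectedGrading 𝒜) (hL : IsCocycleFamily 𝒜 B L)
    (hγ : 0 < γ) (hX : IsRoughPath 𝒜 γ T X) :
    ∃ K : DecoratedTree d → ℝ, ∀ (p : TimePair T) t,
      |(X p.1.1 p.1.2).comp (universalMap L) (MvPolynomial.X t)| ≤ K t := by
  have h : ∀ t : DecoratedTree d, ∃ K, ∀ p : TimePair T,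
      |(X p.1.1 p.1.2).comp (universalMap L) (MvPolynomial.X t)| ≤ K := by
    intro t
    obtain ⟨K, hK⟩ := isBigO_top.1 ((hX.isBigO_tree h𝒜 hL t).trans
      (isBigO_pow_of_le (isBigO_timeScale hγ) (Nat.zero_le _)))
    exact ⟨K, fun p => by simpa using hK p⟩
  choose K hK using h
  exact ⟨K, fun p t => hK t p⟩

/-- The Davie condition is local in time, so a bound is propagated over steps of length `δ / 2`.
Each step expands around a single fixed point `Y s`, and finitely many steps cover `[0, T]`. -/
theorem IsCocycleRDESolution.exists_norm_le (h𝒜 : IsConnectedGrading 𝒜)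
    (hL : IsCocycleFamily 𝒜 B L) (hγ : 0 < γ) (hX : IsRoughPath 𝒜 γ T X) {N : ℕ}
    (hY : IsCocycleRDESolution L f N T X Y) : ∃ C, ∀ t ∈ Set.Icc 0 T, ‖Y t‖ ≤ C := by
  obtain ⟨K, hK⟩ := hX.exists_abs_tree_le h𝒜 hL hγ
  obtain ⟨δ, hδ, hYδ⟩ := hY 1 one_pos
  have key : ∀ k : ℕ, ∃ C, ∀ t ∈ Set.Icc 0 T, t ≤ k * (δ / 2) → ‖Y t‖ ≤ C := by
    intro k
    induction k with
    | zero =>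
      refine ⟨‖Y 0‖, fun t ht htk => ?_⟩
      have h0 : t = 0 := le_antisymm (by simpa using htk) ht.1
      rw [h0]
    | succ k ih =>
      obtain ⟨C, hC⟩ := ih
      set s : ℝ := k * (δ / 2) with hs
      have hs0 : 0 ≤ s := by positivity
      refine ⟨max C (‖Y s‖ + ∑ t ∈ upTo d N, K t / t.symmFactor * ‖elemDiff f t (Y s)‖ + δ),
        fun t ht htk => ?_⟩
      rcases le_or_gt t s with hts | hts
      · exact (hC t ht hts).trans (le_max_left _ _)
      · refine le_trans ?_ (le_max_right _ _)
        have htk' : t - s < δ := by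
          push_cast at htk
          linarith
        have h1 := hYδ s t hs0 hts.le ht.2 htk'
        have h2 := norm_treeSeries_le (f := f) N (Y s)
          ((universalMap L).toLinearMap.dualMap (X s t).toLinearMap)
          (hK ⟨(s, t), hs0, hts, ht.2⟩)
        have h3 := norm_le_insert' (Y t) (treeSeries f N (Y s)
          ((universalMap L).toLinearMap.dualMap (X s t).toLinearMap))
        linarith
  obtain ⟨k, hk⟩ := exists_nat_ge (T / (δ / 2))
  obtain ⟨C, hC⟩ := key k
  refine ⟨C, fun t ht => hC t ht (ht.2.trans ?_)⟩
  rwa [div_le_iff₀ (by positivity)] at hk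

/-- For `t - s < δ` the Davie error is at most `t - s`, which is `O((t - s)^(Nγ))` because `Nγ ≤ 1`.
For longer intervals both terms are bounded and `(t - s)^(Nγ)` is bounded below. -/
theorem IsCocycleRDESolution.isBigO_sub_treeSeries (h𝒜 : IsConnectedGrading 𝒜)
    (hL : IsCocycleFamily 𝒜 B L) (hf : ∀ a, ContDiff ℝ ∞ (f a)) (hγ : 0 < γ)
    (hX : IsRoughPath 𝒜 γ T X) {N : ℕ} (hN : N * γ ≤ 1)
    (hY : IsCocycleRDESolution L f N T X Y) :
    (fun p : TimePair T => Y p.1.2 - treeSeries f N (Y p.1.1)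
      ((X p.1.1 p.1.2).comp (universalMap L)).toLinearMap) =O[⊤]
      fun p => timeScale γ p ^ N := by
  obtain ⟨K, hK⟩ := hX.exists_abs_tree_le h𝒜 hL hγ
  obtain ⟨C, hC⟩ := hY.exists_norm_le h𝒜 hL hγ hX
  choose D hD0 hD using exists_norm_elemDiff_le hf C
  obtain ⟨δ, hδ, hYδ⟩ := hY 1 one_pos
  set A := C + (C + ∑ t ∈ upTo d N, K t / t.symmFactor * D t) with hA
  -- The first summand serves the intervals shorter than `δ`, the second the others; `A` bounds the
  -- norm of the difference.
  refine isBigO_top.2 ⟨T ^ (1 - γ * N) + |A| / δ ^ (γ * N), fun p => ?_⟩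
  rw [Real.norm_of_nonneg (pow_nonneg (timeScale_pos γ _).le _), timeScale_pow]
  have hKp := hK p
  obtain ⟨⟨s, t⟩, h0, h1, h2⟩ := p
  dsimp only at h0 h1 h2 hKp ⊢
  have hts : 0 < t - s := sub_pos.2 h1
  have hT : t - s ≤ T := by linarith
  have hpow : 0 ≤ (t - s) ^ (γ * N) := Real.rpow_nonneg hts.le _
  rw [add_mul]
  rcases lt_or_ge (t - s) δ with hlt | hge
  · have h3 := hYδ s t h0 h1.le h2 hlt
    rw [one_mul] at h3
    refine h3.trans (le_add_of_le_of_nonneg ?_ ?_)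
    · calc t - s = (t - s) ^ (1 - γ * N) * (t - s) ^ (γ * N) := by
            rw [← Real.rpow_add hts, sub_add_cancel, Real.rpow_one]
        _ ≤ _ := mul_le_mul_of_nonneg_right
            (Real.rpow_le_rpow hts.le hT (by linarith [mul_comm γ N])) hpow
    · exact mul_nonneg (div_nonneg (abs_nonneg _) (Real.rpow_nonneg hδ.le _)) hpow
  · refine le_add_of_nonneg_of_le (mul_nonneg (Real.rpow_nonneg (hts.le.trans hT) _) hpow) ?_
    have hYt := hC t ⟨by linarith, h2⟩
    have hYs := hC s ⟨h0, by linarith⟩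
    have h4 : ‖treeSeries f N (Y s) ((X s t).comp (universalMap L)).toLinearMap‖ ≤
        C + ∑ t ∈ upTo d N, K t / t.symmFactor * D t := by
      refine (norm_treeSeries_le N (Y s) _ hKp).trans (add_le_add hYs ?_)
      refine Finset.sum_le_sum fun u _ => mul_le_mul_of_nonneg_left (hD u _ hYs) ?_
      exact div_nonneg ((abs_nonneg _).trans (hKp u)) (symmFactor_pos u).le
    have h5 : |A| ≤ |A| / δ ^ (γ * N) * (t - s) ^ (γ * N) := by
      rw [div_mul_eq_mul_div, le_div_iff₀ (Real.rpow_pos_of_pos hδ _)]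
      exact mul_le_mul_of_nonneg_left (Real.rpow_le_rpow hδ.le hge (by positivity)) (abs_nonneg _)
    refine le_trans ?_ h5
    refine (norm_sub_le _ _).trans (le_trans ?_ (le_abs_self A))
    exact add_le_add hYt h4

/-- An estimate on pairs `s < t` which is trivial for `s = t` holds for `s ≤ t`. -/
theorem exists_norm_le_rpow_of_isBigO {E : Type*} [NormedAddCommGroup E] {F : ℝ → ℝ → E} {n : ℕ}
    (hF : (fun p : TimePair T => F p.1.1 p.1.2) =O[⊤] fun p => timeScale γ p ^ n)
    (h0 : ∀ s, 0 ≤ s → s ≤ T → F s s = 0) :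
    ∃ C : ℝ, ∀ s t : ℝ, 0 ≤ s → s ≤ t → t ≤ T → ‖F s t‖ ≤ C * |t - s| ^ (n * γ) := by
  obtain ⟨C, hC⟩ := isBigO_top.1 hF
  refine ⟨|C|, fun s t hs hst ht => ?_⟩
  rcases eq_or_lt_of_le hst with rfl | hlt
  · rw [h0 s hs ht, norm_zero]
    positivity
  · have h := hC ⟨(s, t), hs, hlt, ht⟩
    rw [Real.norm_of_nonneg (pow_nonneg (timeScale_pos γ _).le _), timeScale_pow] at h
    rw [abs_of_pos (sub_pos.2 hlt), mul_comm (n : ℝ)]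
    exact h.trans (mul_le_mul_of_nonneg_right (le_abs_self C)
      (Real.rpow_nonneg (sub_pos.2 hlt).le _))

theorem IsRoughPath.apply_self (hX : IsRoughPath 𝒜 γ T X) {s : ℝ} (hs : 0 ≤ s) (hs' : s ≤ T)
    (x : H) : X s s x = Coalgebra.counit (R := ℝ) x :=
  eq_counit_of_dualMul_self (hX.chen s s s hs le_rfl le_rfl hs') x

/-- The trees with exactly `N + 1` vertices are themselves of the size of the error. The controlled
expansion uses only degrees below `N + 1`. -/
theorem isBigO_sub_treeSeries_pred {P : Type*} (hf : ∀ a, ContDiff ℝ ∞ (f a)) {lam : P → ℝ}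
    (hlam : lam =O[⊤] fun _ => (1 : ℝ)) {y y' : P → EuclideanSpace ℝ (Fin m)}
    (hy : y =O[⊤] fun _ => (1 : ℝ)) {φ : P → ForestAlgebra d →ₐ[ℝ] ℝ}
    (hφ : ∀ t, (fun p => φ p (MvPolynomial.X t)) =O[⊤] fun p => lam p ^ t.order) {N : ℕ}
    (hyy' : (fun p => y' p - treeSeries f (N + 1) (y p) (φ p).toLinearMap) =O[⊤]
      fun p => lam p ^ (N + 1)) :
    (fun p => y' p - treeSeries f N (y p) (φ p).toLinearMap) =O[⊤] fun p => lam p ^ (N + 1) := by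
  classical
  have hsub : upTo d N ⊆ upTo d (N + 1) := fun t ht =>
    mem_upTo.2 ((mem_upTo.1 ht).trans (Nat.le_succ N))
  have h1 : (fun p => ∑ t ∈ upTo d (N + 1) \ upTo d N,
      (φ p (MvPolynomial.X t) / t.symmFactor) • elemDiff f t (y p)) =O[⊤]
      fun p => lam p ^ (N + 1) := by
    refine IsBigO.fun_sum fun t ht => ?_
    have ht' : N + 1 ≤ t.order := by
      have := (Finset.mem_sdiff.1 ht).2
      rw [mem_upTo] at this
      omega
    simp only [div_eq_inv_mul]
    simpa using (((hφ t).trans (isBigO_pow_of_le hlam ht')).const_mul_left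
      (t.symmFactor : ℝ)⁻¹).smul (isBigO_elemDiff hf hy t)
  refine (hyy'.add h1).congr_left fun p => ?_
  rw [treeSeries, treeSeries, ← Finset.sum_sdiff hsub]
  simp only [AlgHom.toLinearMap_apply]
  abel

theorem isControlledRoughPath_elemDiffPath (h𝒜 : IsConnectedGrading 𝒜)
    (hL : IsCocycleFamily 𝒜 B L)
    (hS : IsOrthogonalHomogeneousBasis 𝒜 B (LinearMap.range (universalMap L).toLinearMap) S)
    (hf : ∀ a, ContDiff ℝ ∞ (f a)) (hγ : 0 < γ) (hX : IsRoughPath 𝒜 γ T X) {N : ℕ}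
    (hN : (N + 1 : ℕ) * γ ≤ 1) (hY : IsCocycleRDESolution L f (N + 1) T X Y) {M : ℕ}
    (hM : N + 1 ≤ M) :
    IsControlledRoughPath 𝒜 B S γ (N + 1) T X (elemDiffPath 𝒜 B L S f M Y) := by
  classical
  have hfin := hS.finite_degreeLT h𝒜 hL (N + 1)
  have hone_mem : (1 : H) ∈ hfin.toFinset := by
    rw [Set.Finite.mem_toFinset]; exact hS.one_mem_degreeLT h𝒜 (Nat.succ_pos N)
  have hmono : ∀ g ∈ degreeLT 𝒜 S (N + 1), g ∈ degreeLT 𝒜 S M := by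
    rintro g ⟨hg, n, hn, hgn⟩
    exact ⟨hg, n, hn.trans_le hM, hgn⟩
  have hcoeff : ∀ t, ∀ g ∈ hfin.toFinset.erase 1, coeffAt B g (elemDiffPath 𝒜 B L S f M Y t) =
      (B g g)⁻¹ • elemDiffBar B L f g (Y t) := by
    intro t g hg
    obtain ⟨hne, hg⟩ := Finset.mem_erase.1 hg
    rw [Set.Finite.mem_toFinset] at hg
    exact coeffAt_elemDiffPath f h𝒜 hL hS M Y t (hmono g hg) hne
  obtain ⟨C, hC⟩ := hY.exists_norm_le h𝒜 hL hγ hX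
  have hys : (fun p : TimePair T => Y p.1.1) =O[⊤] fun _ => (1 : ℝ) :=
    isBigO_top.2 ⟨C, fun p => by
      simpa using hC p.1.1 ⟨p.2.1, by linarith [p.2.2.1, p.2.2.2]⟩⟩
  have hyt : (fun p : TimePair T => Y p.1.2) =O[⊤] fun _ => (1 : ℝ) :=
    isBigO_top.2 ⟨C, fun p => by
      simpa using hC p.1.2 ⟨by linarith [p.2.1, p.2.2.1], p.2.2.2⟩⟩
  have hφ := hX.isBigO_tree h𝒜 hL
  have hlam := isBigO_timeScale (T := T) hγ
  have hyy' := hY.isBigO_sub_treeSeries h𝒜 hL hf hγ hX hN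
  -- The expansion of `Y` over the basis, shared by the first condition and by the second at `h =
  -- 1`.
  have hrem : ∃ C : ℝ, ∀ s t : ℝ, 0 ≤ s → s ≤ t → t ≤ T →
      ‖Y t - (Y s + ∑ h ∈ hfin.toFinset.erase 1,
        X s t h • coeffAt B h (elemDiffPath 𝒜 B L S f M Y s))‖ ≤
        C * |t - s| ^ ((N + 1 : ℕ) * γ) := by
    refine exists_norm_le_rpow_of_isBigO ?_ ?_
    · refine (isBigO_sub_treeSeries_pred hf hlam hys hφ hyy').congr_left fun p => ?_
      have h1 := sum_upTo_eq_sum_degreeLT h𝒜 hL hS f N (X p.1.1 p.1.2).toLinearMap (Y p.1.1)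
      rw [← Finset.add_sum_erase _ _ hone_mem, elemDiffBar_one h𝒜 hL hS, smul_zero, smul_zero,
        zero_add] at h1
      rw [treeSeries]
      congr 2
      refine h1.trans (Finset.sum_congr rfl fun g hg => ?_)
      rw [hcoeff _ g hg]
      rfl
    · intro s hs hs'
      rw [Finset.sum_eq_zero, add_zero, sub_self]
      intro g hg
      obtain ⟨hne, hg⟩ := Finset.mem_erase.1 hg
      rw [Set.Finite.mem_toFinset] at hg
      rw [hX.apply_self hs hs', hS.counit_eq_zero h𝒜 hg.1 hne, zero_smul]
  have hfin' : (degreeLT 𝒜 S (N + 1) \ {1}).Finite := hfin.sdiff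
  have hsdiff : hfin'.toFinset = hfin.toFinset.erase (1 : H) := by
    ext g
    rw [Finset.mem_erase, Set.Finite.mem_toFinset, Set.Finite.mem_toFinset, and_comm]
    rfl
  refine ⟨?_, ?_, fun t _ i => elemDiffPath_mem_span f h𝒜 hL hS M Y t i⟩
  · obtain ⟨C, hC⟩ := hrem
    refine ⟨C, fun s t hs hst ht => ?_⟩
    rw [coeffAt_one_elemDiffPath f h𝒜 hL hS, coeffAt_one_elemDiffPath f h𝒜 hL hS,
      finsum_mem_eq_finite_toFinset_sum _ hfin', hsdiff]
    exact hC s t hs hst ht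
  · intro n hn h hhS hhn
    simp only [finsum_mem_eq_finite_toFinset_sum _ hfin]
    have hh : h ∈ degreeLT 𝒜 S (N + 1) := ⟨hhS, n, hn, hhn⟩
    rcases eq_or_ne h 1 with rfl | hne
    · have hn0 : n = 0 := h𝒜.eq_of_mem hhn
        (by rw [h𝒜.zero_eq]; exact Submodule.mem_span_singleton_self _) hS.one_ne_zero
      subst hn0
      obtain ⟨C, hC⟩ := hrem
      refine ⟨C, fun s t hs hst ht => ?_⟩
      rw [Nat.cast_zero, sub_zero, coeffAt_one_elemDiffPath f h𝒜 hL hS,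
        ← Finset.add_sum_erase _ _ hone_mem, coeffAt_one_elemDiffPath f h𝒜 hL hS,
        dualMul_normalizedDual_one h𝒜 hL hS _ hS.one_mem, map_one, one_smul]
      refine le_of_eq_of_le ?_ (hC s t hs hst ht)
      congr 3
      refine Finset.sum_congr rfl fun g hg => ?_
      have hg' := Finset.mem_of_mem_erase hg
      rw [Set.Finite.mem_toFinset] at hg'
      rw [dualMul_normalizedDual_one h𝒜 hL hS _ hg'.1]
    -- As `n < N + 1`, the natural subtraction is exact and real exponents become powers of
    -- `timeScale`.
    · have hcast : ((N + 1 : ℕ) : ℝ) - n = ((N + 1 - n : ℕ) : ℝ) := by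
        rw [Nat.cast_sub hn.le]
      rw [hcast]
      have hone0 : ∀ s t, dualMul (X s t).toLinearMap (normalizedDual B h) 1 = 0 := by
        intro s t
        rw [dualMul_apply_eq, map_one, normalizedDual_of_ne hS hhS hS.one_mem hne]
      refine exists_norm_le_rpow_of_isBigO ?_ ?_
      · have hsum : (fun p : TimePair T => ∑ u ∈ upTo d N,
            normalizedDual B h (universalMap L (MvPolynomial.X u)) •
              elemDiffRemainder f N ((X p.1.1 p.1.2).comp (universalMap L)) (Y p.1.1) (Y p.1.2) u)
            =O[⊤] fun p => timeScale γ p ^ (N + 1 - n) := by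
          refine IsBigO.fun_sum fun u hu => ?_
          -- Only trees with as many vertices as the degree of `h` pair with it, so every surviving
          -- remainder has order exactly `N + 1 - n`.
          by_cases hun : u.order = n
          · rw [← hun]
            exact (isBigO_elemDiffRemainder_pow_sub hf (timeScale_pos γ) hlam hys hyt hφ hyy'
              (mem_upTo.1 hu)).const_smul_left
                (normalizedDual B h (universalMap L (MvPolynomial.X u)))
          · have h0 : normalizedDual B h (universalMap L (MvPolynomial.X u)) = 0 := by
              rw [normalizedDual, LinearMap.smul_apply,
                hS.pairing_tree_eq_zero h𝒜 hL hhS hhn u hun, smul_zero]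
            simp only [h0, zero_smul]
            exact isBigO_zero _ _
        refine hsum.congr_left fun p => ?_
        rw [← elemDiffBar_sub_sum_eq h𝒜 hL hS f hh hne,
          coeffAt_elemDiffPath f h𝒜 hL hS M Y _ (hmono h hh) hne]
        congr 1
        rw [← Finset.add_sum_erase _ _ hone_mem, ← Finset.add_sum_erase _ _ hone_mem, hone0,
          zero_smul, zero_smul]
        congr 1
        refine Finset.sum_congr rfl fun g hg => ?_
        rw [hcoeff _ g hg]
      -- On the diagonal `X s s` is the counit, the sum reduces to the coefficient of `h`, and the
      -- difference vanishes.
      · intro s hs hs'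
        have hX1 : (X s s).toLinearMap = Coalgebra.counit (R := ℝ) :=
          LinearMap.ext fun x => hX.apply_self hs hs' x
        have hhm : h ∈ hfin.toFinset := by rw [Set.Finite.mem_toFinset]; exact hh
        rw [hX1, counit_dualMul, Finset.sum_eq_single_of_mem h hhm, normalizedDual_self hS hhS,
          one_smul, sub_self]
        intro g hg hgh
        rw [Set.Finite.mem_toFinset] at hg
        rw [normalizedDual_of_ne hS hhS hg.1 hgh.symm, zero_smul]

end Davie

theorem mainTheorem6 {d m : ℕ} {H : Type*} [CommRing H] [HopfAlgebra ℝ H]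
    (𝒜 : ℕ → Submodule ℝ H) (h𝒜 : IsConnectedGrading 𝒜)
    (B : LinearMap.BilinForm ℝ H) (L : Fin d → H →ₗ[ℝ] H) (hL : IsCocycleFamily 𝒜 B L)
    (S : Set H)
    (hS : IsOrthogonalHomogeneousBasis 𝒜 B (LinearMap.range (universalMap L).toLinearMap) S)
    (f : Fin d → EuclideanSpace ℝ (Fin m) → EuclideanSpace ℝ (Fin m))
    (hf : ∀ a, ContDiff ℝ ∞ (f a))
    (γ T : ℝ) (hγ : 0 < γ) (hγ1 : γ ≤ 1)
    (N : ℕ) (hN : IsGreatest {n : ℕ | (n : ℝ) * γ ≤ 1} N)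
    (X : ℝ → ℝ → H →ₐ[ℝ] ℝ) (hX : IsRoughPath 𝒜 γ T X)
    (Y : ℝ → EuclideanSpace ℝ (Fin m)) (hY : IsCocycleRDESolution L f N T X Y)
    (M : ℕ) (hM : N ≤ M) :
    (∀ t, coeffAt B 1 (elemDiffPath 𝒜 B L S f M Y t) = Y t) ∧
    (∀ t, ∀ h ∈ degreeLT 𝒜 S M, h ≠ 1 →
      coeffAt B h (elemDiffPath 𝒜 B L S f M Y t) = (B h h)⁻¹ • elemDiffBar B L f h (Y t)) ∧
    IsControlledRoughPath 𝒜 B S γ N T X (elemDiffPath 𝒜 B L S f M Y) := by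
  -- `γ ≤ 1` gives `N ≥ 1`; writing `N` as a successor makes basis degrees below it correspond to
  -- trees with at most its predecessor many vertices.
  have h1N : 1 ≤ N := hN.2 (by simpa using hγ1)
  obtain ⟨N, rfl⟩ := Nat.exists_eq_add_of_le' h1N
  exact ⟨coeffAt_one_elemDiffPath f h𝒜 hL hS M Y,
    fun t h hh hne => coeffAt_elemDiffPath f h𝒜 hL hS M Y t hh hne,
    isControlledRoughPath_elemDiffPath h𝒜 hL hS hf hγ hX hN.1 hY hM⟩
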